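/- Let $G=(V,E)$ be a finite connected simple graph with at least one edge, drawn in the plane with straight edges, and let $(J_e)_{e\in E}$ be arbitrary real coupling constants, $\beta\in\mathbb R$ and $x_e=\tanh(\beta J_e)$. **Corners and angles.** A corner $c$ of $G$ is the sector at a vertex $v(c)$ between two consecutive edges around $v(c)$ (for a vertex of degree one, between its edge and itself); it belongs to a face $u(c)$. It is drawn as a segment ending at $v(c)$, whose final part lies strictly inside the sector, and it is oriented towards $v(c)$. (In the diamond graph, the segments of a bounded face $u$ all start at a centre of $u$; they may also start at different points, as they do in the unbounded face.) For $e=\{v,v'\}\in E$ and the endpoint $v$, let $\theta$ be the angle at $v$ between the two corners next to $e$, measured across $e$. For $e$ and a side of $e$ with face $u$, let $\theta^*=\pi-\alpha_v-\alpha_{v'}$, where $\alpha_v,\alpha_{v'}\in(0,2\pi)$ are the angles at $v,v'$ between $e$ and the two corners next to $e$ on this side; if these two corners start at a common point on this side of $e$, then $\theta^*$ is the angle between them at this point. The angles $\theta$ around each vertex, the angles $\theta^*$ around each bounded face, and the four angles of each edge sum up to $2\pi$. **The graph $C_G$.** Each corner $c$ gives two vertices of $C_G$, one to the left and one to the right of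 $c$, joined by an edge called a road. Each edge $e$ of $G$ gives four further edges of $C_G$ called streets: for each endpoint $v$ of $e$, a street crossing $e$ which joins the two vertices of $C_G$ next to $e$ at $v$; for each side of $e$, a street crossing the dual edge of $e$ which joins the two vertices of $C_G$ next to $e$ on that side. The graph $C_G$ is bipartite: every edge joins a left vertex to a right vertex. Roads have weight $1$ and phase $-1$; a street crossing $e$ has weight $\frac{1-x_e^2}{1+x_e^2}$ and phase $\exp(\frac i2\theta)$; a street crossing the dual edge of $e$ has weight $\frac{2x_e}{1+x_e^2}$ and phase $\exp(-\frac i2\theta^*)$. Colour the left vertices black and the right vertices white, and let $b_i,w_i$ be the black and white vertices of the corner $c_i$, where $c_1,\dots,c_m$ are all the corners. Let $K(b,w)$ be the weight times the phase of the edge $bw$, summed over the edges joining $b$ and $w$ (so $K(b,w)=0$ if there are none). **The observable.** Let $\mathcal E^\emptyset$ be the set of $\eta\subseteq E$ with even degree at every vertex, and let $\mathcal E^{v(c_i),v(c_j)}$ be the set of $\eta\subseteq E$ such that every vertex has even degree in $\eta\cup\{c_i,c_j\}$ (so it is $\mathcal E^\emptyset$ if $v(c_i)=v(c_j)$). For each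 such $\eta$, connect the edges of $\eta\cup\{c_i,c_j\}$ into pairs around every vertex in a non-crossing way, let $\rho_\eta$ be the resulting path which starts along $c_i$ and ends along $-c_j$, and let $\mathrm{wind}(\rho_\eta)$ be the sum of its turning angles, which are in $(-\pi,\pi)$ and positive for left turns. If $c_i=c_j$, the two corners are connected to each other, and the turning angle of this reversal is taken to be $+\pi$. Put $$f(c_i,c_j)=\frac{\sum_{\eta\in\mathcal E^{v(c_i),v(c_j)}}\exp\left(-\frac i2\mathrm{wind}(\rho_\eta)\right)\prod_{e\in\eta}x_e}{\sum_{\eta\in\mathcal E^\emptyset}\prod_{e\in\eta}x_e}.$$ **Proposition.** Non-crossing connections exist for every such $\eta$, the matrix $K$ is invertible and, for every choice of the non-crossing connections and for all $i,j$, $$K^{-1}(w_i,b_j)=-\frac i2 f(c_i,c_j).$$ For the opposite bipartite colouring of $C_G$ (right vertices black), the matrix is replaced by its transpose, and $K^{-1}(w_i,b_j)=-\frac i2 f(c_j,c_i)$. -/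

import Mathlib

open scoped BigOperators

noncomputable section

namespace PlanarIsing

/-- The counterclockwise angle, in `[0, 2π)`, from the direction `z` to the direction `w`. -/
def ccw (z w : ℂ) : ℝ :=
  if 0 ≤ (w / z).arg then (w / z).arg else (w / z).arg + 2 * Real.pi

/-- The turning angle in `(-π, π]` (positive to the left) of a path which goes in the direction `z`
and then in the direction `w`. -/
def turn (z w : ℂ) : ℝ := (w / z).arg

/-- A straight-line drawing of the graph `G`, together with its corners.

A dart is an edge with an orientation; it is drawn as the segment from `pos d.fst` to `pos d.snd`.
`rot d` is the next dart counterclockwise around the origin of `d`.  The corner of `G` between `d`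
and `rot d` is labelled by `d`: its vertex is `d.fst`, and its face is the face to the left of `d`.
The corner `d` is drawn as the segment from `tip d` to `pos d.fst` (in a diamond graph with straight
edges, `tip d` is the centre of the face of the corner). -/
structure Drawing {V : Type*} (G : SimpleGraph V) where
  pos : V → ℂ
  rot : Equiv.Perm G.Dart
  rot_fst : ∀ d, (rot d).fst = d.fst
  tip : G.Dart → ℂ

/-- Corners, labelled by darts as explained above. -/
abbrev Corner {V : Type*} (G : SimpleGraph V) := G.Dart

namespace Drawing

variable {V : Type*} {G : SimpleGraph V} (D : Drawing G)

/-- The direction of a dart. -/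
def dir (d : G.Dart) : ℂ := D.pos d.snd - D.pos d.fst

/-- The direction of a corner, seen from its vertex. -/
def cornerDir (c : Corner G) : ℂ := D.tip c - D.pos c.fst

/-- The involution reversing all darts. -/
def rev : Equiv.Perm G.Dart where
  toFun d := d.symm
  invFun d := d.symm
  left_inv d := d.symm_symm
  right_inv d := d.symm_symm

/-- The next dart along the boundary of the face to the left of a dart. -/
def faceNext : Equiv.Perm G.Dart := rev.trans D.rot⁻¹

/-- The faces of the drawing are the orbits of `faceNext`. -/
def Face : Type _ := Quotient (Equiv.Perm.SameCycle.setoid D.faceNext)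

/-- The angle from a dart to the corner on its left, at the origin of the dart. -/
def leftAngle (d : G.Dart) : ℝ := ccw (D.dir d) (D.cornerDir d)

/-- The angle from the corner on the right of a dart to this dart, at the origin of the dart. -/
def rightAngle (d : G.Dart) : ℝ := ccw (D.cornerDir (D.rot⁻¹ d)) (D.dir d)

/-- The angle, at the origin of the dart `d`, between the two corners next to `d`: the angle of
the diamond graph assigned to the street which crosses the primal edge `d` next to its origin. -/
def vertexAngle (d : G.Dart) : ℝ := D.rightAngle d + D.leftAngle d

/-- The angle, at the face to the left of `d`, between the two corners next to the edge `d`: the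
angle of the diamond graph assigned to the street which crosses the dual edge of `d` to the left of
`d`.  It is the third angle of the triangle formed by `d` and these two corners, see
`faceAngle_eq_angle`; this form also makes sense if the two corners are not drawn
from a common point (as in the unbounded face), and it makes the four angles around every face of
the diamond graph sum up to `2π`, see `diamond_angle_sum`. -/
def faceAngle (d : G.Dart) : ℝ := Real.pi - D.leftAngle d - D.rightAngle d.symm

theorem diamond_angle_sum (d : G.Dart) :
    D.vertexAngle d + D.vertexAngle d.symm + D.faceAngle d + D.faceAngle d.symm
      = 2 * Real.pi := by
  simp only [vertexAngle, faceAngle, SimpleGraph.Dart.symm_symm]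
  ring

/-- If the two corners to the left of `d` next to `d` are drawn from a common point, lying to the
left of `d`, then `faceAngle d` is the angle between them at this point. -/
theorem faceAngle_eq_angle (d : G.Dart) (p : ℂ) (h₁ : D.tip d = p)
    (h₂ : D.tip (D.faceNext d) = p) (hl : 0 < ((p - D.pos d.fst) / D.dir d).im) :
    D.faceAngle d = EuclideanGeometry.angle (D.pos d.fst) p (D.pos d.snd) := by
  have key : ∀ z : ℂ, 0 < z.im → (if 0 ≤ z.arg then z.arg else z.arg + 2 * Real.pi) = |z.arg| := by
    intro z hz
    have : 0 ≤ z.arg := Complex.arg_nonneg_iff.2 hz.le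
    rw [if_pos this, abs_of_nonneg this]
  have hfst : (D.rot⁻¹ d.symm).fst = d.snd := by
    have := D.rot_fst (D.rot⁻¹ d.symm)
    have e : D.rot (D.rot⁻¹ d.symm) = d.symm := D.rot.apply_symm_apply _
    rw [e] at this
    exact this.symm
  have hne : D.pos d.snd - D.pos d.fst ≠ 0 := by
    intro h
    simp [dir, h] at hl
  have hp : p - D.pos d.fst ≠ 0 := by
    intro h
    simp [h] at hl
  have hq : p - D.pos d.snd ≠ 0 := by
    intro h
    have : p - D.pos d.fst = D.dir d := by
      rw [dir, ← sub_eq_zero]; linear_combination h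
    rw [this, div_self (by simpa [dir] using hne)] at hl
    simp at hl
  have h₂' : D.tip (D.rot⁻¹ d.symm) = p := h₂
  have e1 : D.leftAngle d = EuclideanGeometry.angle p (D.pos d.fst) (D.pos d.snd) := by
    rw [leftAngle, ccw, cornerDir, h₁, key _ hl]
    rw [EuclideanGeometry.angle, vsub_eq_sub, vsub_eq_sub, Complex.angle_eq_abs_arg hp hne]
    rfl
  have hr : 0 < ((D.pos d.fst - D.pos d.snd) / (p - D.pos d.snd)).im := by
    have e : p - D.pos d.snd = D.dir d * ((p - D.pos d.fst) / D.dir d - 1) := by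
      have : D.dir d ≠ 0 := hne
      field_simp
      simp [dir]
    rw [e, ← neg_sub, ← dir]
    set w := (p - D.pos d.fst) / D.dir d with hw
    have hd : D.dir d ≠ 0 := hne
    have hw1 : w - 1 ≠ 0 := by
      intro h
      rw [sub_eq_zero] at h
      simp [h] at hl
    have : -D.dir d / (D.dir d * (w - 1)) = -(w - 1)⁻¹ := by
      field_simp
    rw [this, Complex.neg_im, Complex.inv_im]
    have : 0 < Complex.normSq (w - 1) := Complex.normSq_pos.2 hw1
    have h3 : (w - 1).im = w.im := by simp
    rw [h3, neg_div, neg_neg]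
    positivity
  have e2 : D.rightAngle d.symm = EuclideanGeometry.angle (D.pos d.fst) (D.pos d.snd) p := by
    have hd : D.dir d.symm = D.pos d.fst - D.pos d.snd := rfl
    rw [rightAngle, ccw, cornerDir, h₂', hfst, hd, key _ hr]
    rw [EuclideanGeometry.angle, vsub_eq_sub, vsub_eq_sub,
      Complex.angle_eq_abs_arg (by rw [← neg_sub]; exact neg_ne_zero.2 hne) hq]
  have hne' : D.pos d.fst ≠ D.pos d.snd := fun h => hne (by rw [h, sub_self])
  have := EuclideanGeometry.angle_add_angle_add_angle_eq_pi (p₁ := D.pos d.fst)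
    (p₂ := D.pos d.snd) p hne'.symm
  rw [faceAngle, e1, e2]
  rw [EuclideanGeometry.angle_comm p (D.pos d.fst), EuclideanGeometry.angle_comm (D.pos d.fst) p]
  rw [EuclideanGeometry.angle_comm p (D.pos d.fst)] at this
  linarith

open Classical in
/-- The drawing is a planar drawing of a connected graph: distinct vertices are drawn at distinct
points, every corner is drawn strictly inside the sector between the two darts it lies between,
the angles around every vertex sum up to `2π` (so that `rot` is the counterclockwise rotation),
Euler's formula holds for the faces, and the angles around every face other than the unbounded
one sum up to `2π`. -/
structure IsPlane [Fintype V] [DecidableRel G.Adj] : Prop where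
  connected : G.Connected
  pos_injective : Function.Injective D.pos
  leftAngle_pos : ∀ d, 0 < D.leftAngle d
  rightAngle_pos : ∀ d, 0 < D.rightAngle d
  vertex_sum : ∀ d₀ : G.Dart, ∑ d : G.Dart with d.fst = d₀.fst, D.vertexAngle d = 2 * Real.pi
  euler : Fintype.card V + Nat.card D.Face = G.edgeFinset.card + 2
  face_sum : ∃ outer : G.Dart, ∀ d₀ : G.Dart, ¬ D.faceNext.SameCycle outer d₀ →
    ∑ d : G.Dart with D.faceNext.SameCycle d₀ d, D.faceAngle d = 2 * Real.pi

end Drawing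

/-! ### The graph `C_G` and its Kasteleyn matrix -/

/-- The three kinds of edges of `C_G`: the roads, the streets crossing a primal edge, and the
streets crossing a dual edge. -/
inductive EdgeKind
  | road
  | primalStreet
  | dualStreet
  deriving DecidableEq

instance : Fintype EdgeKind where
  elems := {.road, .primalStreet, .dualStreet}
  complete := by intro k; cases k <;> simp

/-- The edges of `C_G`: the road of the corner `d`; the street crossing the edge of the dart `d`
next to the origin of `d`; the street crossing the dual of the edge of `d` to the left of `d`. -/
abbrev CEdge {V : Type*} (G : SimpleGraph V) := EdgeKind × G.Dart

namespace Drawing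

variable {V : Type*} {G : SimpleGraph V} (D : Drawing G)

/-- Every corner `c` of `G` gives two vertices of `C_G`, joined by the road of `c`: one on the left
and one on the right of `c`, where `c` is oriented from its face to its vertex. Every edge of `C_G`
has one left endpoint and one right endpoint.  This is the corner of the left endpoint. -/
def leftEnd : CEdge G → Corner G
  | (_, d) => d

/-- The corner of the right endpoint of an edge of `C_G`. -/
def rightEnd : CEdge G → Corner G
  | (.road, d) => d
  | (.primalStreet, d) => D.rot⁻¹ d
  | (.dualStreet, d) => D.faceNext d

/-- The weights of the dimer model on `C_G`, for the high-temperature weights `x` on `G`. -/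
def dimerWeight (x : Sym2 V → ℝ) : CEdge G → ℝ
  | (.road, _) => 1
  | (.primalStreet, d) => (1 - x d.edge ^ 2) / (1 + x d.edge ^ 2)
  | (.dualStreet, d) => 2 * x d.edge / (1 + x d.edge ^ 2)

/-- The Kasteleyn phases of the edges of `C_G`. -/
def phase : CEdge G → ℂ
  | (.road, _) => -1
  | (.primalStreet, d) => Complex.exp (Complex.I / 2 * D.vertexAngle d)
  | (.dualStreet, d) => Complex.exp (-(Complex.I / 2) * D.faceAngle d)

/-- The Kasteleyn matrix of `C_G` for the bipartite colouring in which `black e` and `white e` are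
the corners of the black and of the white endpoint of the edge `e`. The rows correspond to the
black vertices and the columns to the white ones. (Parallel edges of `C_G`, which occur at vertices
of `G` of degree one, are summed.) -/
def kasteleyn [Fintype V] [DecidableEq V] [DecidableRel G.Adj] (x : Sym2 V → ℝ)
    (black white : CEdge G → Corner G) : Matrix (Corner G) (Corner G) ℂ :=
  fun b w => ∑ e : CEdge G with black e = b ∧ white e = w, D.phase e * (dimerWeight x e : ℂ)

end Drawing

/-! ### The corner observable -/

section Observable

variable {V : Type*} [Fintype V] [DecidableEq V] (G : SimpleGraph V) [DecidableRel G.Adj]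

/-- The sets of edges of `G` with even degree at every vertex. -/
def evenSets : Finset (Finset (Sym2 V)) :=
  G.edgeFinset.powerset.filter fun η => ∀ v, Even (η.filter fun e => v ∈ e).card

variable {G}

/-- The sets of edges `η` of `G` such that every vertex has even degree in `η` together with the
two corners `c` and `c'`. If `c` and `c'` have different vertices, these are the sets with odd
degree at these two vertices and even degree elsewhere. -/
def sourceSets (c c' : Corner G) : Finset (Finset (Sym2 V)) :=
  G.edgeFinset.powerset.filter fun η => ∀ v, Even ((η.filter fun e => v ∈ e).card
    + (if v = c.fst then 1 else 0) + (if v = c'.fst then 1 else 0))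

end Observable

/-- Half-edges: `inl d` is the half of the edge of `d` next to the origin of `d`; `inr false` and
`inr true` are the two corners at which a path starts and ends. -/
abbrev HalfEdge {V : Type*} (G : SimpleGraph V) := G.Dart ⊕ Bool

/-- The corner at which the path starts. -/
abbrev HalfEdge.start {V : Type*} {G : SimpleGraph V} : HalfEdge G := .inr false

/-- The corner at which the path ends. -/
abbrev HalfEdge.finish {V : Type*} {G : SimpleGraph V} : HalfEdge G := .inr true

namespace Drawing

variable {V : Type*} {G : SimpleGraph V} (D : Drawing G)

/-- The half-edges present in `η ∪ {c, c'}`. -/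
def Present (η : Finset (Sym2 V)) : HalfEdge G → Prop
  | .inl d => d.edge ∈ η
  | .inr _ => True

/-- The vertex of a half-edge of `η ∪ {c, c'}`. -/
def base (c c' : Corner G) : HalfEdge G → V
  | .inl d => d.fst
  | .inr false => c.fst
  | .inr true => c'.fst

/-- The direction of a half-edge of `η ∪ {c, c'}`, seen from its vertex. -/
def outDir (c c' : Corner G) : HalfEdge G → ℂ
  | .inl d => D.dir d
  | .inr false => D.cornerDir c
  | .inr true => D.cornerDir c'

/-- A way to connect the half-edges of `η ∪ {c, c'}` into pairs at every vertex, in a non-crossing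
way: if `h` is connected to `h'`, then the half-edges connected to each other among the remaining
ones at the same vertex lie on the same side of `h ∪ h'`. -/
structure Smoothing (c c' : Corner G) (η : Finset (Sym2 V)) where
  pair : Equiv.Perm (HalfEdge G)
  pair_pair : ∀ h, pair (pair h) = h
  pair_ne_iff : ∀ h, pair h ≠ h ↔ Present η h
  base_pair : ∀ h, base c c' (pair h) = base c c' h
  noncrossing : ∀ h k, Present η h → Present η k → base c c' k = base c c' h →
    k ≠ h → k ≠ pair h →
    (ccw (D.outDir c c' h) (D.outDir c c' k) < ccw (D.outDir c c' h) (D.outDir c c' (pair h)) ↔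
      ccw (D.outDir c c' h) (D.outDir c c' (pair k)) <
        ccw (D.outDir c c' h) (D.outDir c c' (pair h)))

/-- Passing from a half-edge to the other half of the same edge; the final corner is followed by the
initial one. -/
def opposite : Equiv.Perm (HalfEdge G) := Equiv.sumCongr rev Equiv.boolNot

namespace Smoothing

variable {D} {c c' : Corner G} {η : Finset (Sym2 V)} (S : D.Smoothing c c' η)

/-- If a path arrives at a vertex through `h`, it leaves it through `pair h`, and it arrives at the
next vertex through `step h`. -/
def step : Equiv.Perm (HalfEdge G) := S.pair.trans opposite

open Classical in
/-- The winding of the path `ρ_η` which starts along `c` and ends along the reversal of `c'`. The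
half-edges through which the path arrives at its vertices are the ones in the orbit of the initial
corner under `step`; the winding is the sum of all the turning angles. -/
def winding [Fintype V] [DecidableRel G.Adj] : ℝ :=
  ∑ h : HalfEdge G with S.step.SameCycle HalfEdge.start h,
    turn (-D.outDir c c' h) (D.outDir c c' (S.pair h))

end Smoothing

variable [Fintype V] [DecidableEq V] [DecidableRel G.Adj]

/-- A choice of non-crossing connections for all sets of edges entering the observable. -/
abbrev Smoothings (c c' : Corner G) := ∀ η : {η // η ∈ sourceSets c c'}, D.Smoothing c c' η.1

/-- The complex Kadanoff–Ceva corner observable `f(c, c')`, for a given choice of non-crossing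
connections. -/
def observable (x : Sym2 V → ℝ) (c c' : Corner G) (S : D.Smoothings c c') : ℂ :=
  (∑ η : {η // η ∈ sourceSets c c'},
      Complex.exp (-(Complex.I / 2) * (S η).winding) * ∏ e ∈ η.1, (x e : ℂ))
    / ∑ η ∈ evenSets G, ∏ e ∈ η, (x e : ℂ)

end Drawing

end PlanarIsing

end

set_option linter.unusedSectionVars false

namespace PlanarIsing

open Finset

/-! ### Angles between directions -/

/-! Fix the second corner `c₀` and let the first corner `d` move. The phase exp(-i/2 wind) of a set
η with sources at `d` and `c₀` can be described without any path, by its behaviour under elementary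
moves of `d`. Moving `d` around its vertex past an edge gives a half-angle phase, and a factor -1 if
the edge belongs to η. Moving `d` along an edge to the next vertex, while this edge is toggled in η,
gives a half-angle phase. There is one more sign at `c₀`. `IsSpinor` collects these rules and the
value -i at `c₀`. Three facts carry the proof.

The rules are consistent (`IsPlane.exists_isSpinor`). All ambiguities are signs. A square root of
the corner direction has monodromy -1 around every vertex, every bounded face and every edge,
because the angles there sum up to 2π. This and the crossing signs are absorbed by counting, modulo
two, the edges of η on dual paths. By Euler's formula the diamond graph has no cohomology modulo two
in degree one (`IsPlane.exists_potential`), so that it is enough to check consistency around these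
cells.

The spinor is the phase (`IsSpinor.exp_winding`). Follow the path and erase every edge that it
passes. A turn by t sweeps an angle t + π and gives exp(i/2 (t + π)), times -1 for each remaining
half-edge in the swept arc; their number is even since the connections do not cross. Passing along
an edge gives -i, which cancels the exp(iπ/2). So the winding phase does not depend on the
connections.

The spinor sums invert K (`IsSpinor.spinorSum_relation`). Weighting the rules by the products of x
and summing over η gives a three-term relation whose coefficients are a row of K. It holds for each
η separately and is homogeneous except at `c₀`, where the extra sign leaves 2i times the partition
function, which is nonzero because |x| < 1. Hence K times -i/2 f is the identity. The opposite
colouring transposes K. -/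

theorem ccw_nonneg (z w : ℂ) : 0 ≤ ccw z w := by
  unfold ccw
  split_ifs with h
  · exact h
  · linarith [Complex.neg_pi_lt_arg (w / z), Real.pi_pos]

theorem ccw_lt_two_pi (z w : ℂ) : ccw z w < 2 * Real.pi := by
  unfold ccw
  split_ifs with h
  · linarith [Complex.arg_le_pi (w / z), Real.pi_pos]
  · push Not at h
    linarith

theorem ccw_self (z : ℂ) : ccw z z = 0 := by
  unfold ccw
  by_cases hz : z = 0 <;> simp [hz]

theorem ne_zero_of_ccw_pos {z w : ℂ} (h : 0 < ccw z w) : z ≠ 0 ∧ w ≠ 0 := by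
  constructor
  · rintro rfl
    simp [ccw] at h
  · rintro rfl
    simp [ccw] at h

/-- The unit vector in the direction of `z`. -/
noncomputable def unitDir (z : ℂ) : ℂ := z / ‖z‖

theorem unitDir_ne_zero {z : ℂ} (hz : z ≠ 0) : unitDir z ≠ 0 := by
  simp [unitDir, hz]

theorem unitDir_neg (z : ℂ) : unitDir (-z) = -unitDir z := by
  simp [unitDir, neg_div]

theorem unitDir_eq_exp {z : ℂ} (hz : z ≠ 0) : unitDir z = Complex.exp (Complex.I * z.arg) := by
  have h := Complex.norm_mul_exp_arg_mul_I z
  have hn : (‖z‖ : ℂ) ≠ 0 := by simpa using hz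
  rw [unitDir, div_eq_iff hn, mul_comm Complex.I, mul_comm]
  exact h.symm

theorem unitDir_div (z w : ℂ) : unitDir (w / z) = unitDir w / unitDir z := by
  simp only [unitDir, norm_div, Complex.ofReal_div]
  rw [div_div_div_comm]

theorem exp_I_ccw {z w : ℂ} (hz : z ≠ 0) (hw : w ≠ 0) :
    unitDir w = Complex.exp (Complex.I * ccw z w) * unitDir z := by
  have h1 : unitDir (w / z) = Complex.exp (Complex.I * ccw z w) := by
    rw [unitDir_eq_exp (div_ne_zero hw hz), ccw]
    split_ifs with h
    · rfl
    · push_cast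
      rw [mul_add, Complex.exp_add]
      have : Complex.exp (Complex.I * (2 * Real.pi)) = 1 := by
        rw [mul_comm]; exact Complex.exp_two_pi_mul_I
      rw [this, mul_one]
  rw [← h1, unitDir_div, div_mul_cancel₀ _ (unitDir_ne_zero hz)]

theorem eq_of_exp_I_eq {s t : ℝ} (hs : 0 ≤ s) (hs' : s < 2 * Real.pi) (ht : 0 ≤ t)
    (ht' : t < 2 * Real.pi) (h : Complex.exp (Complex.I * s) = Complex.exp (Complex.I * t)) :
    s = t := by
  rw [Complex.exp_eq_exp_iff_exists_int] at h
  obtain ⟨n, hn⟩ := h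
  have hn' : s = t + n * (2 * Real.pi) := by
    have : (s : ℂ) = ((t + n * (2 * Real.pi) : ℝ) : ℂ) := by
      push_cast
      apply mul_left_cancel₀ Complex.I_ne_zero
      rw [hn]; ring
    exact_mod_cast this
  have hp := Real.pi_pos
  have h1 : (n : ℝ) < 1 := by
    by_contra! hc
    nlinarith
  have h2 : (-1 : ℝ) < n := by
    by_contra! hc
    nlinarith
  have h3 : n = 0 := by
    have a : n < 1 := by exact_mod_cast h1
    have b : -1 < n := by exact_mod_cast h2
    omega
  rw [hn', h3]; simp

theorem ccw_eq {z w : ℂ} (hz : z ≠ 0) (hw : w ≠ 0) {t : ℝ} (h0 : 0 ≤ t) (h1 : t < 2 * Real.pi)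
    (h : unitDir w = Complex.exp (Complex.I * t) * unitDir z) : ccw z w = t := by
  refine eq_of_exp_I_eq (ccw_nonneg z w) (ccw_lt_two_pi z w) h0 h1 ?_
  apply mul_right_cancel₀ (unitDir_ne_zero hz)
  rw [← exp_I_ccw hz hw, h]

/-- A path which arrives through a half-edge with outgoing direction `z` travels along `-z`.
Subtracting π maps (0, 2π) into (-π, π), the range of the principal argument, so no multiple of 2π
is left over. -/
theorem turn_neg_left {z w : ℂ} (h : 0 < ccw z w) : turn (-z) w = ccw z w - Real.pi := by
  obtain ⟨hz, hw⟩ := ne_zero_of_ccw_pos h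
  have h2 := ccw_lt_two_pi z w
  have hne : w / -z ≠ 0 := div_ne_zero hw (neg_ne_zero.2 hz)
  have key : Complex.exp (Complex.I * (w / -z).arg) =
      Complex.exp (Complex.I * (ccw z w - Real.pi)) := by
    rw [← unitDir_eq_exp hne, unitDir_div, unitDir_neg, exp_I_ccw hz hw, mul_sub, Complex.exp_sub]
    have : Complex.exp (Complex.I * Real.pi) = -1 := by
      rw [mul_comm]; exact Complex.exp_pi_mul_I
    rw [this]
    field_simp [unitDir_ne_zero hz]
  have h3 := Complex.neg_pi_lt_arg (w / -z)
  have h4 := Complex.arg_le_pi (w / -z)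
  rw [Complex.exp_eq_exp_iff_exists_int] at key
  obtain ⟨n, hn⟩ := key
  have hn' : (w / -z).arg = (ccw z w - Real.pi) + n * (2 * Real.pi) := by
    have : ((w / -z).arg : ℂ) = (((ccw z w - Real.pi) + n * (2 * Real.pi) : ℝ) : ℂ) := by
      push_cast
      apply mul_left_cancel₀ Complex.I_ne_zero
      rw [hn]; ring
    exact_mod_cast this
  have hp := Real.pi_pos
  have h5 : (n : ℝ) < 1 := by
    by_contra! hc
    nlinarith
  have h6 : (-1 : ℝ) < n := by
    by_contra! hc
    nlinarith
  have h7 : n = 0 := by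
    have a : n < 1 := by exact_mod_cast h5
    have b : -1 < n := by exact_mod_cast h6
    omega
  rw [turn, hn', h7]; simp

/-! ### Rotations whose angles sum up to a full turn -/

section Rotation

variable {α : Type*} (σ : Equiv.Perm α) (ang : α → ℝ) (dir : α → ℂ)

theorem unitDir_iterate
    (hstep : ∀ q, unitDir (dir (σ q)) = Complex.exp (Complex.I * ang q) * unitDir (dir q))
    (q : α) (n : ℕ) : unitDir (dir (σ^[n] q)) =
      Complex.exp (Complex.I * (∑ j ∈ range n, ang (σ^[j] q) : ℝ)) * unitDir (dir q) := by
  induction n with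
  | zero => simp
  | succ n ih =>
    rw [Function.iterate_succ_apply', hstep, ih, sum_range_succ]
    push_cast
    rw [mul_add, Complex.exp_add]
    ring

theorem ccw_iterate (hdir : ∀ q, dir q ≠ 0)
    (hstep : ∀ q, unitDir (dir (σ q)) = Complex.exp (Complex.I * ang q) * unitDir (dir q))
    (hpos : ∀ q, 0 < ang q) (q : α) (n : ℕ)
    (hn : ∑ j ∈ range n, ang (σ^[j] q) < 2 * Real.pi) :
    ccw (dir q) (dir (σ^[n] q)) = ∑ j ∈ range n, ang (σ^[j] q) :=
  ccw_eq (hdir q) (hdir _) (sum_nonneg fun _ _ => (hpos _).le) hn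
    (unitDir_iterate σ ang dir hstep q n)

variable [Finite α]

/-- The cycle of `q` returns to its initial direction with a positive total angle, hence with at
least 2π. This already exhausts the total over `s`, so `s` is a single cycle. -/
theorem exists_iterate_of_sum_eq_two_pi (hdir : ∀ q, dir q ≠ 0)
    (hstep : ∀ q, unitDir (dir (σ q)) = Complex.exp (Complex.I * ang q) * unitDir (dir q))
    (hpos : ∀ q, 0 < ang q) {s : Finset α} (hs : ∀ q ∈ s, σ q ∈ s)
    (hsum : ∑ q ∈ s, ang q = 2 * Real.pi) {q p : α} (hq : q ∈ s) (hp : p ∈ s) :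
    ∃ n, σ^[n] q = p ∧ ∑ j ∈ range n, ang (σ^[j] q) < 2 * Real.pi := by
  classical
  set N := Function.minimalPeriod σ q with hN
  have hNpos : 0 < N := Function.minimalPeriod_pos_of_mem_periodicPts
    (Function.Injective.mem_periodicPts σ.injective q)
  have hinj : Set.InjOn (fun j => σ^[j] q) (range N) := by
    intro i hi j hj hij
    simp only [coe_range, Set.mem_Iio] at hi hj
    exact Function.iterate_injOn_Iio_minimalPeriod hi hj hij
  have hmem : ∀ j, σ^[j] q ∈ s := by
    intro j
    induction j with
    | zero => exact hq
    | succ j ih => rw [Function.iterate_succ_apply']; exact hs _ ih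
  have himg : (range N).image (fun j => σ^[j] q) ⊆ s := by
    intro x hx
    obtain ⟨j, -, rfl⟩ := mem_image.1 hx
    exact hmem j
  have hF : ∑ x ∈ (range N).image (fun j => σ^[j] q), ang x
      = ∑ j ∈ range N, ang (σ^[j] q) := sum_image hinj
  have hle : 2 * Real.pi ≤ ∑ j ∈ range N, ang (σ^[j] q) := by
    by_contra! hlt
    have h1 := unitDir_iterate σ ang dir hstep q N
    have h2 : σ^[N] q = q := Function.iterate_minimalPeriod
    rw [h2] at h1
    have h3 := ccw_eq (hdir q) (hdir q) (sum_nonneg fun _ _ => (hpos _).le) hlt h1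
    rw [ccw_self] at h3
    have : 0 < ∑ j ∈ range N, ang (σ^[j] q) :=
      sum_pos (fun j _ => hpos _) ⟨0, mem_range.2 hNpos⟩
    linarith
  -- A point of `s` outside the cycle would add a positive angle and push the total above 2π.
  have hall : s ⊆ (range N).image (fun j => σ^[j] q) := by
    by_contra hn
    have hss : (range N).image (fun j => σ^[j] q) ⊂ s := ⟨himg, hn⟩
    have := sum_lt_sum_of_subset himg (Finset.exists_of_ssubset hss).choose_spec.1
      (Finset.exists_of_ssubset hss).choose_spec.2 (hpos _) (fun j _ _ => (hpos j).le)
    linarith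
  obtain ⟨n, hn, rfl⟩ := mem_image.1 (hall hp)
  refine ⟨n, rfl, ?_⟩
  have : ∑ j ∈ range N, ang (σ^[j] q) ≤ 2 * Real.pi := by
    rw [← hF, ← hsum]
    exact sum_le_sum_of_subset_of_nonneg himg fun j _ _ => (hpos j).le
  refine lt_of_lt_of_le ?_ this
  exact sum_lt_sum_of_subset (range_subset_range.2 (mem_range.1 hn).le) hn (by simp) (hpos _)
    (fun j _ _ => (hpos _).le)

/-- Distinct objects around a vertex point in distinct directions. -/
theorem ccw_pos_of_ne (hdir : ∀ q, dir q ≠ 0)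
    (hstep : ∀ q, unitDir (dir (σ q)) = Complex.exp (Complex.I * ang q) * unitDir (dir q))
    (hpos : ∀ q, 0 < ang q) {s : Finset α} (hs : ∀ q ∈ s, σ q ∈ s)
    (hsum : ∑ q ∈ s, ang q = 2 * Real.pi) {q p : α} (hq : q ∈ s) (hp : p ∈ s) (hne : p ≠ q) :
    0 < ccw (dir q) (dir p) := by
  obtain ⟨n, rfl, hlt⟩ := exists_iterate_of_sum_eq_two_pi σ ang dir hdir hstep hpos hs hsum hq hp
  rw [ccw_iterate σ ang dir hdir hstep hpos q n hlt]
  refine sum_pos (fun _ _ => hpos _) ⟨0, mem_range.2 (Nat.pos_of_ne_zero ?_)⟩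
  rintro rfl
  exact hne rfl

/-- Transport along an arc, for a function which is multiplied by a factor `g q` whenever it is
moved past `q`. -/
theorem transport_arc [DecidableEq α] (hdir : ∀ q, dir q ≠ 0)
    (hstep : ∀ q, unitDir (dir (σ q)) = Complex.exp (Complex.I * ang q) * unitDir (dir q))
    (hpos : ∀ q, 0 < ang q) {s : Finset α} (hs : ∀ q ∈ s, σ q ∈ s)
    (hsum : ∑ q ∈ s, ang q = 2 * Real.pi) {q p : α} (hq : q ∈ s) (hp : p ∈ s) (hne : p ≠ q)
    (Q g : α → ℂ)
    (hQ : ∀ q ∈ s, Q (σ q) = g q * Complex.exp (Complex.I / 2 * ang q) * Q q) :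
    Q p = g q * (∏ x ∈ s with x ≠ q ∧ ccw (dir q) (dir x) < ccw (dir q) (dir p), g x) *
      Complex.exp (Complex.I / 2 * ccw (dir q) (dir p)) * Q q := by
  obtain ⟨n, rfl, hlt⟩ := exists_iterate_of_sum_eq_two_pi σ ang dir hdir hstep hpos hs hsum hq hp
  set F : ℕ → ℝ := fun n => ∑ j ∈ range n, ang (σ^[j] q) with hF
  have hmono : StrictMono F := strictMono_nat_of_lt_succ fun k => by
    simp only [hF, sum_range_succ]
    linarith [hpos (σ^[k] q)]
  have hc : ∀ m, F m < 2 * Real.pi → ccw (dir q) (dir (σ^[m] q)) = F m := fun m hm =>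
    ccw_iterate σ ang dir hdir hstep hpos q m hm
  have hmem : ∀ j, σ^[j] q ∈ s := by
    intro j
    induction j with
    | zero => exact hq
    | succ j ih => rw [Function.iterate_succ_apply']; exact hs _ ih
  have h1 : ∀ m, Q (σ^[m] q) = (∏ j ∈ range m, g (σ^[j] q)) *
      Complex.exp (Complex.I / 2 * (F m : ℝ)) * Q q := by
    intro m
    induction m with
    | zero => simp [hF]
    | succ m ih =>
      rw [Function.iterate_succ_apply', hQ _ (hmem m), ih, prod_range_succ]
      simp only [hF, sum_range_succ]
      push_cast
      rw [mul_add, Complex.exp_add]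
      ring
  obtain ⟨k, rfl⟩ : ∃ k, n = k + 1 := Nat.exists_eq_succ_of_ne_zero (by rintro rfl; exact hne rfl)
  -- The points strictly inside the arc are the iterates 1, ..., k. The iterate 0 is `q` itself,
  -- whose factor `g q` is kept apart.
  have h2 : ∏ x ∈ s with x ≠ q ∧ ccw (dir q) (dir x) < ccw (dir q) (dir (σ^[k + 1] q)), g x
      = ∏ j ∈ range k, g (σ^[j + 1] q) := by
    symm
    refine prod_bij (fun j _ => σ^[j + 1] q) ?_ ?_ ?_ (fun _ _ => rfl)
    · intro j hj
      have hj' : F (j + 1) < F (k + 1) := hmono (by have := mem_range.1 hj; omega)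
      have hj2 : F (j + 1) < 2 * Real.pi := hj'.trans hlt
      rw [mem_filter, hc _ hj2, hc _ hlt]
      refine ⟨hmem _, ?_, hj'⟩
      intro h
      have h3 := hc _ hj2
      rw [h, ccw_self] at h3
      have : F 0 < F (j + 1) := hmono (Nat.succ_pos j)
      simp only [hF, range_zero, sum_empty] at this h3
      linarith
    · intro i hi j hj hij
      have hi' : F (i + 1) < F (k + 1) := hmono (by have := mem_range.1 hi; omega)
      have hj' : F (j + 1) < F (k + 1) := hmono (by have := mem_range.1 hj; omega)
      have h3 := hc _ (hi'.trans hlt)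
      have h4 := hc _ (hj'.trans hlt)
      change σ^[i + 1] q = σ^[j + 1] q at hij
      rw [hij, h4] at h3
      have := hmono.injective h3
      omega
    · intro x hx
      rw [mem_filter, hc _ hlt] at hx
      obtain ⟨hxs, hxq, hxl⟩ := hx
      obtain ⟨m, rfl, hm⟩ :=
        exists_iterate_of_sum_eq_two_pi σ ang dir hdir hstep hpos hs hsum hq hxs
      rw [hc m hm] at hxl
      have hmk := hmono.lt_iff_lt.1 hxl
      obtain ⟨j, rfl⟩ : ∃ j, m = j + 1 :=
        Nat.exists_eq_succ_of_ne_zero (by rintro rfl; exact hxq rfl)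
      exact ⟨j, mem_range.2 (by omega), rfl⟩
  rw [h2, h1, hc _ hlt, prod_range_succ']
  simp only [Function.iterate_zero, id]
  ring

end Rotation

/-! ### Darts, corners and faces of a plane drawing -/

namespace Drawing

section Combinatorics

variable {V : Type*} {G : SimpleGraph V} (D : Drawing G)

theorem rot_rot_inv (d : G.Dart) : D.rot (D.rot⁻¹ d) = d := D.rot.apply_symm_apply d

theorem rot_inv_rot (d : G.Dart) : D.rot⁻¹ (D.rot d) = d := D.rot.symm_apply_apply d

theorem rot_inv_fst (d : G.Dart) : (D.rot⁻¹ d).fst = d.fst := by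
  have := D.rot_fst (D.rot⁻¹ d)
  rw [rot_rot_inv] at this
  exact this.symm

theorem faceNext_apply (d : G.Dart) : D.faceNext d = D.rot⁻¹ d.symm := rfl

theorem faceNext_symm (d : G.Dart) : D.faceNext d.symm = D.rot⁻¹ d := by
  rw [faceNext_apply, SimpleGraph.Dart.symm_symm]

theorem faceNext_fst (d : G.Dart) : (D.faceNext d).fst = d.snd := D.rot_inv_fst d.symm

/-- The face of a corner. -/
def face (d : G.Dart) : D.Face := Quotient.mk _ d

theorem face_eq_iff {d d' : G.Dart} : D.face d = D.face d' ↔ D.faceNext.SameCycle d d' :=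
  Quotient.eq (r := Equiv.Perm.SameCycle.setoid D.faceNext)

theorem face_surjective : Function.Surjective D.face := Quotient.mk_surjective

theorem face_faceNext (d : G.Dart) : D.face (D.faceNext d) = D.face d :=
  D.face_eq_iff.2 (Equiv.Perm.sameCycle_apply_left.2 (Equiv.Perm.SameCycle.refl _ _))

theorem face_rot_inv (d : G.Dart) : D.face (D.rot⁻¹ d) = D.face d.symm := by
  rw [← faceNext_symm, face_faceNext]

instance [Finite G.Dart] : Finite D.Face := Finite.of_surjective D.face D.face_surjective

/-- The next object counterclockwise around a vertex, among the darts `(d, false)` and the corners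
`(d, true)`. -/
noncomputable def next : Equiv.Perm (G.Dart × Bool) where
  toFun q := if q.2 then (D.rot q.1, false) else (q.1, true)
  invFun q := if q.2 then (q.1, false) else (D.rot⁻¹ q.1, true)
  left_inv := by rintro ⟨d, _ | _⟩ <;> simp
  right_inv := by rintro ⟨d, _ | _⟩ <;> simp

@[simp] theorem next_false (d : G.Dart) : D.next (d, false) = (d, true) := rfl
@[simp] theorem next_true (d : G.Dart) : D.next (d, true) = (D.rot d, false) := rfl

/-- The angle from a dart or a corner to the next object around its vertex. -/
noncomputable def nextAngle (q : G.Dart × Bool) : ℝ := if q.2 then D.rightAngle (D.rot q.1) else D.leftAngle q.1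

/-- The direction of a dart or a corner. -/
noncomputable def objDir (q : G.Dart × Bool) : ℂ := if q.2 then D.cornerDir q.1 else D.dir q.1

end Combinatorics

section Plane

variable {V : Type*} [Fintype V] {G : SimpleGraph V} [DecidableRel G.Adj] {D : Drawing G}

theorem IsPlane.dir_ne_zero (hD : D.IsPlane) (d : G.Dart) : D.dir d ≠ 0 :=
  (ne_zero_of_ccw_pos (hD.leftAngle_pos d)).1

theorem IsPlane.cornerDir_ne_zero (hD : D.IsPlane) (d : G.Dart) : D.cornerDir d ≠ 0 :=
  (ne_zero_of_ccw_pos (hD.leftAngle_pos d)).2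

theorem IsPlane.objDir_ne_zero (hD : D.IsPlane) (q : G.Dart × Bool) : D.objDir q ≠ 0 := by
  obtain ⟨d, _ | _⟩ := q
  · exact hD.dir_ne_zero d
  · exact hD.cornerDir_ne_zero d

theorem IsPlane.unitDir_left (hD : D.IsPlane) (d : G.Dart) :
    unitDir (D.cornerDir d) = Complex.exp (Complex.I * D.leftAngle d) * unitDir (D.dir d) :=
  exp_I_ccw (hD.dir_ne_zero d) (hD.cornerDir_ne_zero d)

theorem IsPlane.unitDir_right (hD : D.IsPlane) (d : G.Dart) :
    unitDir (D.dir d) =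
      Complex.exp (Complex.I * D.rightAngle d) * unitDir (D.cornerDir (D.rot⁻¹ d)) :=
  exp_I_ccw (hD.cornerDir_ne_zero _) (hD.dir_ne_zero d)

theorem IsPlane.unitDir_next (hD : D.IsPlane) (q : G.Dart × Bool) : unitDir (D.objDir (D.next q)) =
    Complex.exp (Complex.I * D.nextAngle q) * unitDir (D.objDir q) := by
  obtain ⟨d, _ | _⟩ := q
  · exact hD.unitDir_left d
  · simpa [objDir, nextAngle] using hD.unitDir_right (D.rot d)

theorem IsPlane.nextAngle_pos (hD : D.IsPlane) (q : G.Dart × Bool) : 0 < D.nextAngle q := by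
  obtain ⟨d, _ | _⟩ := q
  · exact hD.leftAngle_pos d
  · exact hD.rightAngle_pos _

theorem sum_faceNext {M : Type*} [AddCommMonoid M] [DecidableEq D.Face] (c : D.Face)
    (f : G.Dart → M) : ∑ d : G.Dart with D.face d = c, f (D.faceNext d) =
      ∑ d : G.Dart with D.face d = c, f d := by
  refine sum_equiv D.faceNext ?_ fun _ _ => rfl
  intro d
  simp [D.face_faceNext]

theorem IsPlane.eq_of_adj (hD : D.IsPlane) {β : Type*} {h : V → β}
    (h1 : ∀ d : G.Dart, h d.fst = h d.snd) (v v' : V) : h v = h v' := by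
  obtain ⟨p⟩ := hD.connected v v'
  induction p with
  | nil => rfl
  | cons hadj q ih => exact (h1 ⟨(_, _), hadj⟩).trans ih

variable [DecidableEq V]

/-- The darts and the corners at a vertex. -/
def objectsAt (G : SimpleGraph V) [DecidableRel G.Adj] (v : V) : Finset (G.Dart × Bool) :=
  univ.filter fun q => q.1.fst = v

theorem mem_objectsAt {v : V} {q : G.Dart × Bool} : q ∈ objectsAt G v ↔ q.1.fst = v := by
  simp [objectsAt]

theorem next_mem_objectsAt {v : V} : ∀ q ∈ objectsAt G v, D.next q ∈ objectsAt G v := by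
  rintro ⟨d, _ | _⟩ h
  · simpa [mem_objectsAt] using h
  · simpa [mem_objectsAt, D.rot_fst] using h

theorem sum_rot {M : Type*} [AddCommMonoid M] (v : V) (f : G.Dart → M) :
    ∑ d : G.Dart with d.fst = v, f (D.rot⁻¹ d) = ∑ d : G.Dart with d.fst = v, f d := by
  refine sum_equiv D.rot⁻¹ ?_ fun _ _ => rfl
  intro d
  rw [mem_filter_univ, mem_filter_univ, D.rot_inv_fst]

theorem exists_dart (hD : D.IsPlane) (v : V) : ∃ d : G.Dart, d.fst = v := by
  -- The outer dart shows that there is at least one edge, which excludes the graph with a single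
  -- vertex.
  obtain ⟨o, -⟩ := hD.face_sum
  by_cases h : v = o.fst
  · exact ⟨o, h.symm⟩
  · obtain ⟨p⟩ := hD.connected v o.fst
    cases p with
    | nil => exact absurd rfl h
    | cons hadj q => exact ⟨⟨(_, _), hadj⟩, rfl⟩

theorem IsPlane.sum_vertexAngle (hD : D.IsPlane) (v : V) :
    ∑ d : G.Dart with d.fst = v, D.vertexAngle d = 2 * Real.pi := by
  obtain ⟨d, rfl⟩ := exists_dart hD v
  convert hD.vertex_sum d

theorem IsPlane.sum_nextAngle (hD : D.IsPlane) (v : V) :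
    ∑ q ∈ objectsAt G v, D.nextAngle q = 2 * Real.pi := by
  rw [← hD.sum_vertexAngle v, objectsAt]
  have h : (univ.filter fun q : G.Dart × Bool => q.1.fst = v)
      = (univ.filter fun d : G.Dart => d.fst = v) ×ˢ (univ : Finset Bool) := by
    ext q; simp
  rw [h, sum_product]
  have h2 : ∀ d : G.Dart, ∑ b : Bool, D.nextAngle (d, b)
      = D.rightAngle (D.rot d) + D.leftAngle d := by
    intro d; simp [nextAngle]
  simp only [h2, vertexAngle, sum_add_distrib]
  congr 1
  rw [← sum_rot (D := D) v fun d => D.rightAngle (D.rot d)]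
  simp

/-- The angle sum 2π makes `rot` transitive on the darts at a vertex. -/
theorem IsPlane.eq_of_rot (hD : D.IsPlane) {β : Type*} {h : G.Dart → β}
    (h1 : ∀ d, h (D.rot⁻¹ d) = h d) {d d' : G.Dart} (hdd : d.fst = d'.fst) : h d = h d' := by
  obtain ⟨n, hn, -⟩ := exists_iterate_of_sum_eq_two_pi D.next D.nextAngle D.objDir
    hD.objDir_ne_zero hD.unitDir_next hD.nextAngle_pos next_mem_objectsAt
    (hD.sum_nextAngle d.fst) (q := (d, true)) (p := (d', true)) (mem_objectsAt.2 rfl)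
    (mem_objectsAt.2 hdd.symm)
  have key : ∀ n, h (D.next^[n] (d, true)).1 = h d := by
    intro n
    induction n with
    | zero => rfl
    | succ n ih =>
      rw [Function.iterate_succ_apply', ← ih]
      generalize D.next^[n] (d, true) = q
      obtain ⟨a, _ | _⟩ := q
      · rfl
      · rw [next_true, ← h1 (D.rot a)]; simp
  rw [← key n, hn]

/-- Since `faceNext` goes to the other endpoint of an edge, connectedness makes `rot` and `faceNext`
together transitive on all darts. -/
theorem IsPlane.eq_of_rot_of_faceNext (hD : D.IsPlane) {β : Type*} {h : G.Dart → β}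
    (h1 : ∀ d, h (D.rot⁻¹ d) = h d) (h2 : ∀ d, h (D.faceNext d) = h d) (d d' : G.Dart) :
    h d = h d' := by
  choose δ hδ using exists_dart hD
  have h3 := hD.eq_of_adj (h := fun v => h (δ v)) (fun a => by
    have e1 : h (δ a.fst) = h a := hD.eq_of_rot h1 (hδ _)
    have e2 : h (δ a.snd) = h (D.faceNext a) := hD.eq_of_rot h1 ((hδ _).trans (D.faceNext_fst a).symm)
    rw [e1, e2, h2]) d.fst d'.fst
  have e1 : h (δ d.fst) = h d := hD.eq_of_rot h1 (hδ _)
  have e2 : h (δ d'.fst) = h d' := hD.eq_of_rot h1 (hδ _)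
  rw [← e1, ← e2]
  exact h3

end Plane

/-! ### Cohomology modulo two of the diamond graph -/

section Cohomology

variable {V : Type*} [Fintype V] {G : SimpleGraph V} [DecidableRel G.Adj] {D : Drawing G}

theorem finrank_le_one_of_forall_eq {ι K : Type*} [Field K] [Finite ι]
    (W : Submodule K (ι → K)) (h : ∀ φ ∈ W, ∀ i j, φ i = φ j) : Module.finrank K W ≤ 1 := by
  have hle : W ≤ Submodule.span K {fun _ => 1} := by
    intro φ hφ
    rw [Submodule.mem_span_singleton]
    cases isEmpty_or_nonempty ι with
    | inl h0 => exact ⟨0, funext fun i => (h0.false i).elim⟩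
    | inr h0 =>
      obtain ⟨i⟩ := h0
      exact ⟨φ i, funext fun j => by simpa using h φ hφ i j⟩
  refine (Submodule.finrank_mono hle).trans ?_
  exact (finrank_span_le_card _).trans (by simp)

/-- The boundary matrix, modulo two, of the moves between corners (around a vertex or along an
edge) in the cells of the diamond graph (the vertices, the faces and the edges of `G`). -/
def cellMatrix [DecidableEq V] [DecidableEq D.Face] :
    Matrix ((V ⊕ D.Face) ⊕ G.edgeSet) (G.Dart ⊕ G.Dart) (ZMod 2) := fun c m =>
  (if Sum.inl (Sum.elim (fun d => .inl d.fst) (fun d => .inr (D.face d)) m) = c then 1 else 0) +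
  (if Sum.inr (Sum.elim (fun d => ⟨d.edge, d.edge_mem⟩) (fun d => ⟨d.edge, d.edge_mem⟩) m) = c
    then 1 else 0)

theorem sum_edge_fiber {M : Type*} [AddCommMonoid M] [DecidableEq V] (d : G.Dart) (f : G.Dart → M) :
    ∑ d' : G.Dart with d'.edge = d.edge, f d' = f d + f d.symm := by
  rw [SimpleGraph.Dart.edge_fiber, sum_pair d.symm_ne.symm]

/-- The diamond graph of a planar drawing has no cohomology modulo two in degree one: a function on
the moves between the corners whose sum vanishes around every vertex, every edge and every face
except possibly one is a coboundary. -/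
theorem IsPlane.exists_potential [DecidableEq V] [DecidableEq D.Face] (hD : D.IsPlane)
    (aP aF : G.Dart → ZMod 2) (o : G.Dart)
    (hv : ∀ v, ∑ d : G.Dart with d.fst = v, aP d = 0)
    (hf : ∀ f, f ≠ D.face o → ∑ d : G.Dart with D.face d = f, aF d = 0)
    (he : ∀ d, aP d + aF d + (aP d.symm + aF d.symm) = 0) :
    ∃ g : G.Dart → ZMod 2, ∀ d, g d = g (D.rot⁻¹ d) + aP d ∧ g d = g (D.faceNext d) + aF d := by
  classical
  have : Fintype D.Face := Fintype.ofFinite _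
  have hPF : ∑ d : G.Dart, (aP d + aF d) = 0 :=
    sum_involution (fun d _ => d.symm) (fun d _ => he d) (fun d _ _ => d.symm_ne)
      (fun _ _ => mem_univ _) (fun d _ => d.symm_symm)
  have hP : ∑ d : G.Dart, aP d = 0 := by
    rw [← sum_fiberwise univ (fun d : G.Dart => d.fst)]
    exact sum_eq_zero fun v _ => hv v
  have hF : ∑ d : G.Dart, aF d = 0 := by
    rw [sum_add_distrib, hP, zero_add] at hPF
    exact hPF
  -- The vertex and edge conditions force the total of `aF` to vanish, so the condition at the
  -- exceptional face is automatic.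
  have hf' : ∀ f, ∑ d : G.Dart with D.face d = f, aF d = 0 := by
    intro f
    by_cases h : f = D.face o
    · rw [← sum_fiberwise univ D.face, sum_eq_single (D.face o) (fun f _ h => hf f h)
        (fun h => absurd (mem_univ _) h)] at hF
      rw [h]
      exact hF
    · exact hf f h
  set B : Matrix ((V ⊕ D.Face) ⊕ G.edgeSet) (G.Dart ⊕ G.Dart) (ZMod 2) := cellMatrix with hB
  set δ : (G.Dart → ZMod 2) →ₗ[ZMod 2] (G.Dart ⊕ G.Dart → ZMod 2) :=
    { toFun := fun g => Sum.elim (fun d => g d + g (D.rot⁻¹ d)) (fun d => g d + g (D.faceNext d))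
      map_add' := by
        intro g g'
        funext m
        rcases m with d | d <;> simp only [Sum.elim_inl, Sum.elim_inr, Pi.add_apply] <;> ring
      map_smul' := by
        intro r g
        funext m
        rcases m with d | d <;>
          simp only [Sum.elim_inl, Sum.elim_inr, Pi.smul_apply, smul_add, RingHom.id_apply] } with hδ
  have hBv : ∀ (a : G.Dart ⊕ G.Dart → ZMod 2) v, (B.mulVec a) (.inl (.inl v)) =
      ∑ d : G.Dart with d.fst = v, a (.inl d) := by
    intro a v
    simp [hB, cellMatrix, Matrix.mulVec, dotProduct, Fintype.sum_sum_type, sum_filter]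
  have hBf : ∀ (a : G.Dart ⊕ G.Dart → ZMod 2) f, (B.mulVec a) (.inl (.inr f)) =
      ∑ d : G.Dart with D.face d = f, a (.inr d) := by
    intro a v
    simp [hB, cellMatrix, Matrix.mulVec, dotProduct, Fintype.sum_sum_type, sum_filter]
  have hBe : ∀ (a : G.Dart ⊕ G.Dart → ZMod 2) (d : G.Dart),
      (B.mulVec a) (.inr ⟨d.edge, d.edge_mem⟩) =
      a (.inl d) + a (.inr d) + (a (.inl d.symm) + a (.inr d.symm)) := by
    intro a d
    have h1 := sum_edge_fiber d fun d => a (.inl d)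
    have h2 := sum_edge_fiber d fun d => a (.inr d)
    rw [sum_filter] at h1 h2
    have : (B.mulVec a) (.inr ⟨d.edge, d.edge_mem⟩) = (a (.inl d) + a (.inl d.symm))
        + (a (.inr d) + a (.inr d.symm)) := by
      rw [← h1, ← h2]
      simp [hB, cellMatrix, Matrix.mulVec, dotProduct, Fintype.sum_sum_type]
    rw [this]; ring
  have hcell : ∀ a, (∀ v, ∑ d : G.Dart with d.fst = v, a (.inl d) = 0) →
      (∀ f, ∑ d : G.Dart with D.face d = f, a (.inr d) = 0) →
      (∀ d, a (.inl d) + a (.inr d) + (a (.inl d.symm) + a (.inr d.symm)) = 0) →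
      B.mulVec a = 0 := by
    intro a h1 h2 h3
    funext c
    rcases c with (v | f) | ⟨e, he⟩
    · rw [hBv]; exact h1 v
    · rw [hBf]; exact h2 f
    · obtain ⟨d, rfl⟩ : ∃ d : G.Dart, d.edge = e := by
        induction e with
        | _ x y => exact ⟨⟨(x, y), he⟩, rfl⟩
      rw [hBe]; exact h3 d
  -- Each move lies in exactly two cells, one of them an edge of `G`, so an element of the kernel
  -- takes equal values on incident cells and is constant by connectedness.
  have hBT : ∀ (φ : (V ⊕ D.Face) ⊕ G.edgeSet → ZMod 2), φ ∈ LinearMap.ker B.transpose.mulVecLin →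
      ∀ i j, φ i = φ j := by
    intro φ hφ
    rw [LinearMap.mem_ker] at hφ
    have e1 : ∀ d : G.Dart, φ (.inl (.inl d.fst)) = φ (.inr ⟨d.edge, d.edge_mem⟩) := by
      intro d
      have := congrFun hφ (.inl d)
      simp [hB, cellMatrix, Matrix.vecMul, dotProduct, mul_add, sum_add_distrib] at this
      exact CharTwo.add_eq_zero.1 this
    have e2 : ∀ d : G.Dart, φ (.inl (.inr (D.face d))) = φ (.inr ⟨d.edge, d.edge_mem⟩) := by
      intro d
      have := congrFun hφ (.inr d)
      simp [hB, cellMatrix, Matrix.vecMul, dotProduct, mul_add, sum_add_distrib] at this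
      exact CharTwo.add_eq_zero.1 this
    have e3 : ∀ v v', φ (.inl (.inl v)) = φ (.inl (.inl v')) := hD.eq_of_adj
      (h := fun v => φ (.inl (.inl v))) fun d => by
        rw [e1 d]
        have := e1 d.symm
        simp only [SimpleGraph.Dart.edge_symm] at this
        exact this.symm
    have e4 : ∀ c, φ c = φ (.inl (.inl o.fst)) := by
      rintro ((v | f) | ⟨e, he⟩)
      · exact e3 _ _
      · obtain ⟨d, rfl⟩ := D.face_surjective f
        rw [e2, ← e1]; exact e3 _ _
      · obtain ⟨d, rfl⟩ : ∃ d : G.Dart, d.edge = e := by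
          induction e with
          | _ x y => exact ⟨⟨(x, y), he⟩, rfl⟩
        rw [← e1]; exact e3 _ _
    intro i j
    rw [e4 i, e4 j]
  have hker : ∀ g ∈ LinearMap.ker δ, ∀ i j, g i = g j := by
    intro g hg
    rw [LinearMap.mem_ker] at hg
    refine hD.eq_of_rot_of_faceNext (fun d => ?_) (fun d => ?_)
    · exact (CharTwo.add_eq_zero.1 (congrFun hg (.inl d))).symm
    · exact (CharTwo.add_eq_zero.1 (congrFun hg (.inr d))).symm
  -- Coboundaries telescope around the orbits of `rot` and of `faceNext`, and around the four-cycle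
  -- of moves at an edge.
  have hle : LinearMap.range δ ≤ LinearMap.ker B.mulVecLin := by
    rintro _ ⟨g, rfl⟩
    rw [LinearMap.mem_ker]
    refine hcell _ (fun v => ?_) (fun f => ?_) (fun d => ?_)
    · change ∑ d : G.Dart with d.fst = v, (g d + g (D.rot⁻¹ d)) = 0
      rw [sum_add_distrib, sum_rot, CharTwo.add_self_eq_zero]
    · change ∑ d : G.Dart with D.face d = f, (g d + g (D.faceNext d)) = 0
      rw [sum_add_distrib, sum_faceNext, CharTwo.add_self_eq_zero]
    · change g d + g (D.rot⁻¹ d) + (g d + g (D.faceNext d)) + (g d.symm + g (D.rot⁻¹ d.symm) +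
        (g d.symm + g (D.faceNext d.symm))) = 0
      rw [D.faceNext_symm, D.faceNext_apply]
      linear_combination (g d + g d.symm + g (D.rot⁻¹ d) + g (D.rot⁻¹ d.symm)) *
        (CharTwo.two_eq_zero : (2 : ZMod 2) = 0)
  have hrange : LinearMap.range δ = LinearMap.ker B.mulVecLin := by
    refine Submodule.eq_of_le_of_finrank_le hle ?_
    -- With E edges there are 2E corners, 4E moves and, by Euler's formula, 2E + 2 cells. So δ has
    -- rank at least 2E - 1 and B has rank at least 2E + 1, which leaves a kernel of dimension at
    -- most 4E - (2E + 1) = 2E - 1.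
    have r1 := LinearMap.finrank_range_add_finrank_ker δ
    have r2 := LinearMap.finrank_range_add_finrank_ker B.mulVecLin
    have r3 := LinearMap.finrank_range_add_finrank_ker B.transpose.mulVecLin
    have r4 : Module.finrank (ZMod 2) (LinearMap.range B.transpose.mulVecLin)
        = Module.finrank (ZMod 2) (LinearMap.range B.mulVecLin) := Matrix.rank_transpose B
    have k1 := finrank_le_one_of_forall_eq _ hker
    have k2 := finrank_le_one_of_forall_eq _ hBT
    have c1 : Fintype.card G.Dart = 2 * G.edgeFinset.card := G.dart_card_eq_twice_card_edges
    have c2 : Fintype.card G.edgeSet = G.edgeFinset.card := by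
      convert (SimpleGraph.edgeFinset_card (G := G)).symm
    have c3 : Fintype.card V + Fintype.card D.Face = G.edgeFinset.card + 2 := by
      have := hD.euler
      rw [Nat.card_eq_fintype_card] at this
      convert this
    simp only [Module.finrank_fintype_fun_eq_card, Fintype.card_sum] at r1 r2 r3
    rw [c2] at r3
    omega
  have hmem : (Sum.elim aP aF : G.Dart ⊕ G.Dart → ZMod 2) ∈ LinearMap.range δ := by
    rw [hrange, LinearMap.mem_ker]
    exact hcell _ hv hf' he
  obtain ⟨g, hg⟩ := hmem
  refine ⟨g, fun d => ⟨?_, ?_⟩⟩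
  · have := congrFun hg (.inl d)
    change g d + g (D.rot⁻¹ d) = aP d at this
    rw [← this, ← add_assoc, add_right_comm, CharTwo.add_self_eq_zero, zero_add]
  · have := congrFun hg (.inr d)
    change g d + g (D.faceNext d) = aF d at this
    rw [← this, ← add_assoc, add_right_comm, CharTwo.add_self_eq_zero, zero_add]

/-- A set of edges which meets every face an even number of times is a cut. -/
theorem IsPlane.exists_cut [DecidableEq V] [DecidableEq D.Face] (hD : D.IsPlane)
    (κ : Sym2 V → ZMod 2) (hκ : ∀ f, ∑ d : G.Dart with D.face d = f, κ d.edge = 0) :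
    ∃ S : V → ZMod 2, ∀ d : G.Dart, κ d.edge = S d.fst + S d.snd := by
  obtain ⟨o, -⟩ := hD.face_sum
  -- With zero increments around the vertices, the potential is constant on the corners at each
  -- vertex, hence a function on `V`.
  obtain ⟨g, hg⟩ := hD.exists_potential (fun _ => 0) (fun d => κ d.edge) o (by simp)
    (fun f _ => hκ f) (fun d => by simp [CharTwo.add_self_eq_zero])
  choose δ hδ using exists_dart hD
  have hrot : ∀ d, g (D.rot⁻¹ d) = g d := fun d => by simpa using (hg d).1.symm
  refine ⟨fun v => g (δ v), fun d => ?_⟩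
  have e1 : g (δ d.fst) = g d := hD.eq_of_rot hrot (hδ _)
  have e2 : g (δ d.snd) = g (D.faceNext d) :=
    hD.eq_of_rot hrot ((hδ _).trans (D.faceNext_fst d).symm)
  change _ = g (δ d.fst) + g (δ d.snd)
  rw [e1, e2, (hg d).2, add_right_comm, CharTwo.add_self_eq_zero, zero_add]

end Cohomology

end Drawing

/-- The sign `(-1) ^ a`. -/
noncomputable def sign (a : ZMod 2) : ℂ := if a = 0 then 1 else -1

@[simp] theorem sign_zero : sign 0 = 1 := if_pos rfl

@[simp] theorem sign_one : sign 1 = -1 := if_neg one_ne_zero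

theorem zmod_two_cases (a : ZMod 2) : a = 0 ∨ a = 1 := by
  revert a; decide

theorem sign_add (a b : ZMod 2) : sign (a + b) = sign a * sign b := by
  rcases zmod_two_cases a with rfl | rfl <;> rcases zmod_two_cases b with rfl | rfl <;>
    simp [CharTwo.add_self_eq_zero]

theorem sign_mul_self (a : ZMod 2) : sign a * sign a = 1 := by
  rw [← sign_add, CharTwo.add_self_eq_zero, sign_zero]

theorem sign_ne_zero (a : ZMod 2) : sign a ≠ 0 := by
  rcases zmod_two_cases a with rfl | rfl <;> simp

theorem sign_eq_neg_one {a : ZMod 2} : sign a = -1 ↔ a = 1 := by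
  rcases zmod_two_cases a with rfl | rfl <;> norm_num

theorem sign_sum {ι : Type*} (s : Finset ι) (f : ι → ZMod 2) :
    sign (∑ i ∈ s, f i) = ∏ i ∈ s, sign (f i) := by
  classical
  induction s using Finset.induction_on with
  | empty => simp
  | insert a s ha ih => rw [sum_insert ha, prod_insert ha, sign_add, ih]

theorem exists_sign_of_sq_eq {a b : ℂ} (h : a ^ 2 = b ^ 2) : ∃ s, a = sign s * b := by
  rcases sq_eq_sq_iff_eq_or_eq_neg.1 h with h | h
  · exact ⟨0, by simp [h]⟩
  · exact ⟨1, by simp [h]⟩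

theorem exp_neg_half_pi_mul_two : Complex.exp (-(Complex.I / 2) * (2 * Real.pi : ℝ)) = -1 := by
  have : (-(Complex.I / 2) * (2 * Real.pi : ℝ)) = -(Real.pi * Complex.I) := by
    push_cast; ring
  rw [this, Complex.exp_neg, Complex.exp_pi_mul_I]; norm_num

theorem exp_half_pi_mul_two : Complex.exp (Complex.I / 2 * (2 * Real.pi : ℝ)) = -1 := by
  have : (Complex.I / 2 * (2 * Real.pi : ℝ)) = Real.pi * Complex.I := by
    push_cast; ring
  rw [this, Complex.exp_pi_mul_I]

/-! ### Sources modulo two -/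

section Sources

variable {V : Type*} [Fintype V] [DecidableEq V] {G : SimpleGraph V} [DecidableRel G.Adj]

theorem mem_sourceSets {c c' : Corner G} {η : Finset (Sym2 V)} :
    η ∈ sourceSets c c' ↔ η ⊆ G.edgeFinset ∧ ∀ v, ((η.filter fun e => v ∈ e).card : ZMod 2)
      = (if v = c.fst then 1 else 0) + (if v = c'.fst then 1 else 0) := by
  rw [sourceSets, mem_filter, mem_powerset]
  refine and_congr_right fun _ => forall_congr' fun v => ?_
  rw [← ZMod.natCast_eq_zero_iff_even]
  push_cast
  rw [add_assoc, CharTwo.add_eq_zero]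

theorem mem_evenSets {η : Finset (Sym2 V)} :
    η ∈ evenSets G ↔ η ⊆ G.edgeFinset ∧ ∀ v, ((η.filter fun e => v ∈ e).card : ZMod 2) = 0 := by
  rw [evenSets, mem_filter, mem_powerset]
  refine and_congr_right fun _ => forall_congr' fun v => ?_
  rw [← ZMod.natCast_eq_zero_iff_even]

theorem sourceSets_eq_evenSets {c c' : Corner G} (h : c.fst = c'.fst) :
    sourceSets c c' = evenSets G := by
  ext η
  rw [mem_sourceSets, mem_evenSets, h]
  simp only [CharTwo.add_self_eq_zero]

theorem sourceSets_congr {c d c' : Corner G} (h : c.fst = d.fst) :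
    sourceSets c c' = sourceSets d c' := by
  ext η
  rw [mem_sourceSets, mem_sourceSets, h]

theorem sum_symmDiff {ι : Type*} [DecidableEq ι] (s : Finset ι) (a : ι) (f : ι → ZMod 2) :
    ∑ i ∈ symmDiff s {a}, f i = ∑ i ∈ s, f i + f a := by
  by_cases h : a ∈ s
  · have : symmDiff s {a} = s.erase a := by
      ext x; by_cases hx : x = a <;> simp [mem_symmDiff, hx, h]
    rw [this, ← add_sum_erase s f h, add_right_comm, CharTwo.add_self_eq_zero, zero_add]
  · have : symmDiff s {a} = insert a s := by
      ext x; by_cases hx : x = a <;> simp [mem_symmDiff, hx, h]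
    rw [this, sum_insert h, add_comm]

theorem card_filter_eq_sum (η : Finset (Sym2 V)) (v : V) :
    ((η.filter fun e => v ∈ e).card : ZMod 2) = ∑ e ∈ η, if v ∈ e then 1 else 0 := by
  simp

/-- Toggling an edge moves a source from one of its endpoints to the other. This accompanies every
move of a corner along an edge. -/
theorem symmDiff_mem_sourceSets {c c' : Corner G} {η : Finset (Sym2 V)} (d : G.Dart)
    (hd : d.fst = c.snd) (h : η ∈ sourceSets c c') :
    symmDiff η {c.edge} ∈ sourceSets d c' := by
  rw [mem_sourceSets] at h ⊢
  refine ⟨?_, fun v => ?_⟩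
  · intro e he
    rw [mem_symmDiff, mem_singleton] at he
    rcases he with ⟨he, -⟩ | ⟨rfl, -⟩
    · exact h.1 he
    · simp
  · rw [card_filter_eq_sum, sum_symmDiff, ← card_filter_eq_sum, h.2 v, hd]
    have hne : c.fst ≠ c.snd := c.fst_ne_snd
    have he : v ∈ c.edge ↔ v = c.fst ∨ v = c.snd := by
      rw [SimpleGraph.Dart.edge]; exact Sym2.mem_iff
    simp only [he]
    by_cases h1 : v = c.fst <;> by_cases h2 : v = c.snd
    · exact absurd (h1.symm.trans h2) hne
    · simp only [h1, hne, if_true, if_false, true_or]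
      linear_combination (CharTwo.two_eq_zero : (2 : ZMod 2) = 0)
    · simp only [h2, hne.symm, if_true, if_false, or_true]
      ring
    · simp [h1, h2]

/-- Summation by parts: `κ` is the coboundary of `S`, and only the sources have odd degree in `η`
together with no corner; two sources at the same vertex cancel on both sides. -/
theorem sum_cut {c c' : Corner G} {η : Finset (Sym2 V)} (h : η ∈ sourceSets c c')
    {κ : Sym2 V → ZMod 2} {S : V → ZMod 2} (hκ : ∀ d : G.Dart, κ d.edge = S d.fst + S d.snd) :
    ∑ e ∈ η, κ e = S c.fst + S c'.fst := by
  rw [mem_sourceSets] at h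
  have h1 : ∀ e ∈ η, κ e = ∑ v, if v ∈ e then S v else 0 := by
    intro e he
    have he' := SimpleGraph.mem_edgeFinset.1 (h.1 he)
    induction e with
    | _ a b =>
      have hab : a ≠ b := fun h => by
        subst h; exact G.loopless.irrefl _ he'
      have := hκ ⟨(a, b), he'⟩
      rw [SimpleGraph.Dart.edge] at this
      change κ s(a, b) = _ at this
      rw [this, ← sum_filter]
      have : (univ.filter fun v => v ∈ s(a, b)) = {a, b} := by
        ext v; simp
      rw [this, sum_pair hab]
  rw [sum_congr rfl h1, sum_comm]
  have h2 : ∀ v, ∑ e ∈ η, (if v ∈ e then S v else 0) =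
      (if v = c.fst then S v else 0) + (if v = c'.fst then S v else 0) := by
    intro v
    have h3 := h.2 v
    rw [card_filter_eq_sum] at h3
    have h4 : ∑ e ∈ η, (if v ∈ e then S v else 0) = (∑ e ∈ η, if v ∈ e then 1 else 0) * S v := by
      rw [sum_mul]; exact sum_congr rfl fun e _ => by split_ifs <;> simp
    rw [h4, h3, add_mul]
    congr 1 <;> split_ifs <;> simp
  simp [h2, sum_add_distrib]

end Sources

/-! ### Square roots of the corner directions and their signs -/

namespace Drawing

section Spin

variable {V : Type*} [Fintype V] [DecidableEq V] {G : SimpleGraph V} [DecidableRel G.Adj]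
  {D : Drawing G}

/-- A square root of the direction of a corner. -/
noncomputable def cornerRoot (D : Drawing G) (d : Corner G) : ℂ :=
  Complex.exp (Complex.I / 2 * (D.cornerDir d).arg)

theorem cornerRoot_ne_zero (d : Corner G) : D.cornerRoot d ≠ 0 := Complex.exp_ne_zero _

theorem IsPlane.cornerRoot_sq (hD : D.IsPlane) (d : Corner G) :
    D.cornerRoot d ^ 2 = unitDir (D.cornerDir d) := by
  rw [unitDir_eq_exp (hD.cornerDir_ne_zero d), cornerRoot, ← Complex.exp_nat_mul]
  congr 1
  push_cast; ring

theorem IsPlane.unitDir_rot (hD : D.IsPlane) (d : G.Dart) : unitDir (D.cornerDir d) =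
    Complex.exp (Complex.I * D.vertexAngle d) * unitDir (D.cornerDir (D.rot⁻¹ d)) := by
  rw [hD.unitDir_left, hD.unitDir_right, vertexAngle, ← mul_assoc, ← Complex.exp_add]
  congr 2
  push_cast; ring

theorem dir_symm (d : G.Dart) : D.dir d.symm = -D.dir d := by
  simp [dir]

/-- The dart is seen in opposite directions from its two ends, which is compensated by the π in
`faceAngle`. -/
theorem IsPlane.unitDir_faceNext (hD : D.IsPlane) (d : G.Dart) : unitDir (D.cornerDir d) =
    Complex.exp (-Complex.I * D.faceAngle d) * unitDir (D.cornerDir (D.faceNext d)) := by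
  have h1 := hD.unitDir_right d.symm
  rw [dir_symm, unitDir_neg] at h1
  rw [hD.unitDir_left, faceNext_apply, ← neg_neg (unitDir (D.dir d)), h1, faceAngle]
  have : Complex.exp (-Complex.I * (Real.pi - D.leftAngle d - D.rightAngle d.symm : ℝ))
      = -(Complex.exp (Complex.I * D.leftAngle d) *
        Complex.exp (Complex.I * D.rightAngle d.symm)) := by
    rw [← Complex.exp_add, ← neg_one_mul (Complex.exp _), ← Complex.exp_neg_pi_mul_I,
      ← Complex.exp_add]
    congr 1
    push_cast; ring
  rw [this]; ring

/-- Both sides are square roots of the same unit vector by `IsPlane.unitDir_rot`. The sign ε records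
how the chosen roots differ from continuous transport. -/
theorem IsPlane.exists_rotSign (hD : D.IsPlane) : ∃ ε : G.Dart → ZMod 2, ∀ d, D.cornerRoot d =
    sign (ε d) * (Complex.exp (Complex.I / 2 * D.vertexAngle d) * D.cornerRoot (D.rot⁻¹ d)) := by
  choose ε hε using fun d => exists_sign_of_sq_eq (a := D.cornerRoot d)
    (b := Complex.exp (Complex.I / 2 * D.vertexAngle d) * D.cornerRoot (D.rot⁻¹ d)) (by
      rw [mul_pow, hD.cornerRoot_sq, hD.cornerRoot_sq, hD.unitDir_rot, ← Complex.exp_nat_mul]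
      congr 2
      push_cast; ring)
  exact ⟨ε, hε⟩

theorem IsPlane.exists_faceSign (hD : D.IsPlane) : ∃ ε : G.Dart → ZMod 2, ∀ d, D.cornerRoot d =
    sign (ε d) *
      (Complex.exp (-(Complex.I / 2) * D.faceAngle d) * D.cornerRoot (D.faceNext d)) := by
  choose ε hε using fun d => exists_sign_of_sq_eq (a := D.cornerRoot d)
    (b := Complex.exp (-(Complex.I / 2) * D.faceAngle d) * D.cornerRoot (D.faceNext d)) (by
      rw [mul_pow, hD.cornerRoot_sq, hD.cornerRoot_sq, hD.unitDir_faceNext, ← Complex.exp_nat_mul]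
      congr 2
      push_cast; ring)
  exact ⟨ε, hε⟩

/-- If a nonvanishing function is multiplied by signs and phases when it is transported along a
cycle, and if the angles sum up to `2π`, then the product of the signs is `-1`. -/
theorem sum_sign_eq_one {ι : Type*} {s : Finset ι} {σ : Equiv.Perm ι} (hσ : ∀ i, i ∈ s ↔ σ i ∈ s)
    {A : ι → ℂ} (hA : ∀ i, A i ≠ 0) {ε : ι → ZMod 2} {θ : ι → ℝ} {z : ℂ}
    (hz : Complex.exp (z * (2 * Real.pi : ℝ)) = -1)
    (h : ∀ i, A i = sign (ε i) * (Complex.exp (z * θ i) * A (σ i)))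
    (hθ : ∑ i ∈ s, θ i = 2 * Real.pi) : ∑ i ∈ s, ε i = 1 := by
  rw [← sign_eq_neg_one, sign_sum]
  have h1 : ∏ i ∈ s, A (σ i) = ∏ i ∈ s, A i := prod_equiv σ hσ fun _ _ => rfl
  have h2 : ∏ i ∈ s, A i =
      (∏ i ∈ s, sign (ε i)) * ((∏ i ∈ s, Complex.exp (z * θ i)) * ∏ i ∈ s, A (σ i)) := by
    rw [← prod_mul_distrib, ← prod_mul_distrib]
    exact prod_congr rfl fun i _ => h i
  rw [h1, ← Complex.exp_sum, ← mul_sum, ← Complex.ofReal_sum, hθ, hz] at h2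
  have h3 : ∏ i ∈ s, A i ≠ 0 := prod_ne_zero_iff.2 fun i _ => hA i
  apply mul_right_cancel₀ h3
  linear_combination h2

/-- The two vertex moves and the two face moves of an edge join the same two pairs of corners, and
their half-angles sum up to π; this makes the monodromy around the edge -1. -/
theorem diamond_sign {ε ε' : G.Dart → ZMod 2}
    (hε : ∀ d, D.cornerRoot d = sign (ε d) *
      (Complex.exp (Complex.I / 2 * D.vertexAngle d) * D.cornerRoot (D.rot⁻¹ d)))
    (hε' : ∀ d, D.cornerRoot d = sign (ε' d) *
      (Complex.exp (-(Complex.I / 2) * D.faceAngle d) * D.cornerRoot (D.faceNext d)))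
    (d : G.Dart) : ε d + ε' d + (ε d.symm + ε' d.symm) = 1 := by
  have h1 := hε d
  have h2 := hε' d
  have h3 := hε d.symm
  have h4 := hε' d.symm
  rw [faceNext_symm] at h4
  rw [faceNext_apply] at h2
  have e1 : D.cornerRoot (D.rot⁻¹ d) ≠ 0 := cornerRoot_ne_zero _
  have e2 : D.cornerRoot (D.rot⁻¹ d.symm) ≠ 0 := cornerRoot_ne_zero _
  rw [← sign_eq_neg_one, sign_add, sign_add, sign_add]
  have key : Complex.exp (Complex.I / 2 * D.vertexAngle d) *
      Complex.exp (Complex.I / 2 * D.vertexAngle d.symm) =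
      -(Complex.exp (-(Complex.I / 2) * D.faceAngle d) *
      Complex.exp (-(Complex.I / 2) * D.faceAngle d.symm)) := by
    rw [← Complex.exp_add, ← Complex.exp_add, ← neg_one_mul, ← exp_half_pi_mul_two,
      ← D.diamond_angle_sum d, ← Complex.exp_add]
    congr 1
    push_cast; ring
  have h5 := congrArg₂ (· * ·) h1 h3
  have h6 := congrArg₂ (· * ·) h2 h4
  have h7 := h5.symm.trans h6
  set F := Complex.exp (-(Complex.I / 2) * D.faceAngle d) *
      Complex.exp (-(Complex.I / 2) * D.faceAngle d.symm) with hF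
  have hF0 : F ≠ 0 := mul_ne_zero (Complex.exp_ne_zero _) (Complex.exp_ne_zero _)
  have h8 : sign (ε d) * sign (ε d.symm) * (-F) = sign (ε' d) * sign (ε' d.symm) * F := by
    rw [← key, hF]
    apply mul_right_cancel₀ (mul_ne_zero e1 e2)
    linear_combination h7
  have h9 : sign (ε d) * sign (ε d.symm) = -(sign (ε' d) * sign (ε' d.symm)) := by
    apply mul_right_cancel₀ hF0
    linear_combination -h8
  linear_combination (sign (ε' d) * sign (ε' d.symm)) * h9 -
    (sign (ε' d.symm) * sign (ε' d.symm)) * sign_mul_self (ε' d) - sign_mul_self (ε' d.symm)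

variable [DecidableEq D.Face]

/-- Every face is joined to a given one by a path in the dual graph. -/
theorem IsPlane.exists_dual_path (hD : D.IsPlane) (o : G.Dart) (f : D.Face) :
    ∃ γ : Sym2 V → ZMod 2, ∀ f', ∑ d : G.Dart with D.face d = f', γ d.edge =
      (if f' = f then 1 else 0) + (if f' = D.face o then 1 else 0) := by
  set p : D.Face → Prop := fun f => ∃ γ : Sym2 V → ZMod 2, ∀ f',
    ∑ d : G.Dart with D.face d = f', γ d.edge =
      (if f' = f then 1 else 0) + (if f' = D.face o then 1 else 0) with hp
  have key : ∀ d, p (D.face d) → p (D.face d.symm) := by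
    rintro d ⟨γ, hγ⟩
    refine ⟨fun e => γ e + if e = d.edge then 1 else 0, fun f' => ?_⟩
    have h1 : ∑ d' : G.Dart with D.face d' = f', (if d'.edge = d.edge then (1 : ZMod 2) else 0)
        = (if f' = D.face d then 1 else 0) + (if f' = D.face d.symm then 1 else 0) := by
      have := sum_edge_fiber d fun d' => if D.face d' = f' then (1 : ZMod 2) else 0
      rw [sum_filter] at this
      simp only [eq_comm (a := f')]
      rw [← this, sum_filter]
      refine sum_congr rfl fun d' _ => ?_
      split_ifs <;> rfl
    rw [sum_add_distrib, h1, hγ]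
    linear_combination (if f' = D.face d then (1 : ZMod 2) else 0) *
      (CharTwo.two_eq_zero : (2 : ZMod 2) = 0)
  have h0 : p (D.face o) := ⟨0, fun f' => by simp [CharTwo.add_self_eq_zero]⟩
  obtain ⟨d, rfl⟩ := D.face_surjective f
  have := hD.eq_of_rot_of_faceNext (h := fun d => p (D.face d)) (fun d => by
    rw [face_rot_inv]
    refine propext ⟨fun h => ?_, key d⟩
    have := key _ h
    rwa [SimpleGraph.Dart.symm_symm] at this) (fun d => by rw [face_faceNext]) o d
  exact Eq.mp this h0

end Spin

/-! ### Existence of the spinor -/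

section Spinor

variable {V : Type*} [Fintype V] [DecidableEq V] {G : SimpleGraph V} [DecidableRel G.Adj]
  {D : Drawing G}

/-- A function of a corner `d` and of a set of edges with sources at `d` and `c₀`, with the
monodromy of the fermionic observable: the term of the observable which corresponds to a set of
edges is such a function. -/
structure IsSpinor (D : Drawing G) (c₀ : Corner G) (P : Corner G → Finset (Sym2 V) → ℂ) :
    Prop where
  rot : ∀ d, ∀ η ∈ sourceSets d c₀, P d η =
    sign ((if d = c₀ then 1 else 0) + (if d.edge ∈ η then 1 else 0)) *
      (Complex.exp (Complex.I / 2 * D.vertexAngle d) * P (D.rot⁻¹ d) η)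
  face : ∀ d, ∀ η ∈ sourceSets d c₀, P d η = sign (if d = c₀ then 1 else 0) *
    (Complex.exp (-(Complex.I / 2) * D.faceAngle d) * P (D.faceNext d) (symmDiff η {d.edge}))
  source : ∀ η ∈ sourceSets c₀ c₀, P c₀ η = -Complex.I

/-- The spinor is a root of the corner direction times (-1) to the number of edges of η on a dual
path from the face of `d` to the face of `c₀`, corrected by a sign `g d` which does not depend on η.
The sign at `c₀` enters both moves with the same corner on the left of the equation, so it acts
across the road of `c₀`. -/
theorem IsPlane.exists_isSpinor (hD : D.IsPlane) (c₀ : Corner G) : ∃ P, IsSpinor D c₀ P := by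
  classical
  have two : (2 : ZMod 2) = 0 := CharTwo.two_eq_zero
  obtain ⟨o, ho⟩ := hD.face_sum
  obtain ⟨ε, hε⟩ := hD.exists_rotSign
  obtain ⟨ε', hε'⟩ := hD.exists_faceSign
  have hdia := diamond_sign hε hε'
  have hεv : ∀ v, ∑ d : G.Dart with d.fst = v, ε d = 1 := fun v =>
    sum_sign_eq_one (σ := D.rot⁻¹) (fun d => by rw [mem_filter_univ, mem_filter_univ, D.rot_inv_fst])
      cornerRoot_ne_zero exp_half_pi_mul_two hε (hD.sum_vertexAngle v)
  have hεf : ∀ f, f ≠ D.face o → ∑ d : G.Dart with D.face d = f, ε' d = 1 := by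
    intro f hf
    obtain ⟨d₀, rfl⟩ := D.face_surjective f
    refine sum_sign_eq_one (σ := D.faceNext) (fun d => by
      rw [mem_filter_univ, mem_filter_univ, D.face_faceNext])
      cornerRoot_ne_zero exp_neg_half_pi_mul_two hε' ?_
    refine Eq.trans (sum_congr ?_ fun _ _ => rfl) (ho d₀ fun h => hf (D.face_eq_iff.2 h).symm)
    ext d
    simp only [mem_filter, mem_univ, true_and]
    rw [← face_eq_iff, eq_comm]
  -- `γ f` is a dual path from `f` to the face of `c₀`. It is taken empty for the face of `c₀`, so
  -- that the value at `c₀` does not depend on η.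
  obtain ⟨γ, hγ, hγ₀⟩ : ∃ γ : D.Face → Sym2 V → ZMod 2, (∀ f f',
      ∑ d : G.Dart with D.face d = f', γ f d.edge =
        (if f' = f then 1 else 0) + (if f' = D.face c₀ then 1 else 0)) ∧ γ (D.face c₀) = 0 := by
    choose γ hγ using hD.exists_dual_path c₀
    refine ⟨fun f => if f = D.face c₀ then 0 else γ f, fun f f' => ?_, by simp⟩
    by_cases h : f = D.face c₀
    · simp [h, CharTwo.add_self_eq_zero]
    · simp [h, hγ]
  -- The dual paths from the two sides of an edge, closed by the dual of this edge, form a dual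
  -- cycle, which is a cut. By `sum_cut` its parity on η is then known from the sources alone.
  have hcut : ∀ d : G.Dart, ∃ S : V → ZMod 2, ∀ d' : G.Dart,
      γ (D.face d) d'.edge + γ (D.face d.symm) d'.edge + (if d'.edge = d.edge then 1 else 0) =
        S d'.fst + S d'.snd := by
    intro d
    refine hD.exists_cut (fun e => γ (D.face d) e + γ (D.face d.symm) e +
      (if e = d.edge then 1 else 0)) fun f => ?_
    have h1 : ∑ d' : G.Dart with D.face d' = f, (if d'.edge = d.edge then (1 : ZMod 2) else 0)
        = (if f = D.face d then 1 else 0) + (if f = D.face d.symm then 1 else 0) := by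
      have := sum_edge_fiber d fun d' => if D.face d' = f then (1 : ZMod 2) else 0
      rw [sum_filter] at this
      simp only [eq_comm (a := f)]
      rw [← this, sum_filter]
      refine sum_congr rfl fun d' _ => ?_
      split_ifs <;> rfl
    rw [sum_add_distrib, sum_add_distrib, hγ, hγ, h1]
    linear_combination ((if f = D.face d then (1 : ZMod 2) else 0) +
      (if f = D.face d.symm then (1 : ZMod 2) else 0) +
      (if f = D.face c₀ then (1 : ZMod 2) else 0)) * two
  choose S hS using hcut
  -- These increments are what remains of the two rules after the terms depending on η cancel.
  obtain ⟨g, hg⟩ : ∃ g : G.Dart → ZMod 2, ∀ d,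
      g d = g (D.rot⁻¹ d) + (ε d + (if d = c₀ then 1 else 0) + (S d d.fst + S d c₀.fst)) ∧
      g d = g (D.faceNext d) + (ε' d + (if d = c₀ then 1 else 0) + γ (D.face d) d.edge) := by
    refine hD.exists_potential
      (fun d => ε d + (if d = c₀ then 1 else 0) + (S d d.fst + S d c₀.fst))
      (fun d => ε' d + (if d = c₀ then 1 else 0) + γ (D.face d) d.edge) o ?_ ?_ ?_
    · intro v
      rw [sum_add_distrib, sum_add_distrib, hεv, sum_add_distrib]
      -- The faces next to the darts at `v` occur twice, so the γ terms cancel in the sum of the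
      -- cuts. What remains is the coboundary of the indicator of `v`, and connectedness makes the
      -- difference constant.
      have h1 : ∀ w w', (∑ d : G.Dart with d.fst = v, S d w) + (if w = v then 1 else 0) =
          (∑ d : G.Dart with d.fst = v, S d w') + (if w' = v then 1 else 0) := by
        refine hD.eq_of_adj (h := fun w => (∑ d : G.Dart with d.fst = v, S d w) +
          (if w = v then 1 else 0)) fun a => ?_
        have h2 : ∑ d : G.Dart with d.fst = v, (S d a.fst + S d a.snd) =
            (if a.fst = v then 1 else 0) + (if a.snd = v then 1 else 0) := by
          rw [← sum_congr rfl fun d _ => hS d a, sum_add_distrib, sum_add_distrib]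
          have h3 := sum_rot (D := D) v fun d => γ (D.face d) a.edge
          simp only [face_rot_inv] at h3
          rw [h3, CharTwo.add_self_eq_zero, zero_add]
          have := sum_edge_fiber a fun d => if d.fst = v then (1 : ZMod 2) else 0
          rw [sum_filter] at this
          refine Eq.trans ?_ this
          rw [sum_filter]
          refine sum_congr rfl fun d' _ => ?_
          simp only [eq_comm (a := a.edge)]
          split_ifs <;> rfl
        rw [sum_add_distrib] at h2
        linear_combination h2 - (∑ d : G.Dart with d.fst = v, S d a.snd +
          (if a.snd = v then 1 else 0)) * two + ((if a.fst = v then 1 else 0) + (if a.snd = v then 1 else 0)) * two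
      have h4 := h1 v c₀.fst
      have h5 : ∑ d : G.Dart with d.fst = v, (if d = c₀ then (1 : ZMod 2) else 0) =
          if c₀.fst = v then 1 else 0 := by
        simp only [sum_ite_eq', mem_filter_univ]
      have h6 : ∑ d : G.Dart with d.fst = v, S d d.fst = ∑ d : G.Dart with d.fst = v, S d v :=
        sum_congr rfl fun d hd => by rw [(mem_filter.1 hd).2]
      rw [h5, h6]
      simp only [if_true] at h4
      linear_combination h4 + (∑ d : G.Dart with d.fst = v, S d c₀.fst +
        (if c₀.fst = v then 1 else 0)) * two
    · intro f hf
      rw [sum_add_distrib, sum_add_distrib, hεf f hf]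
      have h1 : ∑ d : G.Dart with D.face d = f, γ (D.face d) d.edge =
          ∑ d : G.Dart with D.face d = f, γ f d.edge :=
        sum_congr rfl fun d hd => by rw [(mem_filter.1 hd).2]
      have h5 : ∑ d : G.Dart with D.face d = f, (if d = c₀ then (1 : ZMod 2) else 0) =
          if D.face c₀ = f then 1 else 0 := by
        simp only [sum_ite_eq', mem_filter_univ]
      rw [h1, hγ, h5, if_pos rfl]
      simp only [eq_comm (a := D.face c₀)]
      linear_combination (1 + (if f = D.face c₀ then 1 else 0)) * two
    · intro d
      have h1 := hdia d
      have h2 := hS d d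
      -- `S d` and `S d.symm` have the same coboundary, so their sum is constant.
      have h3 : ∀ w w', S d w + S d.symm w = S d w' + S d.symm w' := by
        refine hD.eq_of_adj (h := fun w => S d w + S d.symm w) fun a => ?_
        have e1 := hS d a
        have e2 := hS d.symm a
        rw [SimpleGraph.Dart.symm_symm, SimpleGraph.Dart.edge_symm] at e2
        linear_combination -e1 - e2 + (γ (D.face d) a.edge + γ (D.face d.symm) a.edge +
          (if a.edge = d.edge then 1 else 0) - S d a.snd - S d.symm a.snd) * two
      have h4 := h3 c₀.fst d.snd
      simp only [if_true] at h2
      rw [SimpleGraph.Dart.edge_symm]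
      change _ + (ε d.symm + _ + (S d.symm d.snd + _) + _) = 0
      linear_combination h1 + h4 - h2 + ((if d = c₀ then 1 else 0) +
        (if d.symm = c₀ then 1 else 0) + S d.symm d.snd + γ (D.face d) d.edge +
        γ (D.face d.symm) d.edge + 1) * two
  refine ⟨fun d η => -Complex.I / (D.cornerRoot c₀ * sign (g c₀)) *
    (D.cornerRoot d * sign (g d + ∑ e ∈ η, γ (D.face d) e)), ?_, ?_, ?_⟩
  · intro d η hη
    have h1 := sum_cut hη (κ := fun e => γ (D.face d) e + γ (D.face d.symm) e +
      (if e = d.edge then 1 else 0)) (hS d)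
    rw [sum_add_distrib, sum_add_distrib, sum_ite_eq'] at h1
    have h2 : ε d + (g d + ∑ e ∈ η, γ (D.face d) e) =
        ((if d = c₀ then 1 else 0) + (if d.edge ∈ η then 1 else 0)) +
          (g (D.rot⁻¹ d) + ∑ e ∈ η, γ (D.face (D.rot⁻¹ d)) e) := by
      rw [face_rot_inv]
      linear_combination (hg d).1 - h1 + (ε d + ∑ e ∈ η, γ (D.face d) e) * two
    have h3 := congrArg sign h2
    rw [sign_add, sign_add (_ + _)] at h3
    rw [hε d]
    linear_combination (-Complex.I / (D.cornerRoot c₀ * sign (g c₀)) *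
      Complex.exp (Complex.I / 2 * D.vertexAngle d) * D.cornerRoot (D.rot⁻¹ d)) * h3
  · intro d η hη
    have h2 : ε' d + (g d + ∑ e ∈ η, γ (D.face d) e) =
        (if d = c₀ then 1 else 0) + (g (D.faceNext d) +
          ∑ e ∈ symmDiff η {d.edge}, γ (D.face (D.faceNext d)) e) := by
      rw [face_faceNext, sum_symmDiff]
      linear_combination (hg d).2 + (ε' d) * two
    have h3 := congrArg sign h2
    rw [sign_add, sign_add (ite _ _ _)] at h3
    rw [hε' d]
    linear_combination (-Complex.I / (D.cornerRoot c₀ * sign (g c₀)) *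
      Complex.exp (-(Complex.I / 2) * D.faceAngle d) * D.cornerRoot (D.faceNext d)) * h3
  · intro η _
    simp only [hγ₀, Pi.zero_apply, sum_const_zero, add_zero]
    exact div_mul_cancel₀ _ (mul_ne_zero (cornerRoot_ne_zero _) (sign_ne_zero _))

end Spinor

/-! ### Transport of a spinor around a vertex and along an edge -/

/-- The dart or the corner of a half-edge. -/
def object {V : Type*} {G : SimpleGraph V} (c c' : Corner G) : HalfEdge G → G.Dart × Bool
  | .inl d => (d, false)
  | .inr false => (c, true)
  | .inr true => (c', true)

theorem objDir_object {V : Type*} {G : SimpleGraph V} (D : Drawing G) (c c' : Corner G)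
    (h : HalfEdge G) : D.objDir (object c c' h) = D.outDir c c' h := by
  rcases h with d | _ | _ <;> rfl

theorem object_fst {V : Type*} {G : SimpleGraph V} (c c' : Corner G)
    (h : HalfEdge G) : (object c c' h).1.fst = base c c' h := by
  rcases h with d | _ | _ <;> rfl

theorem object_injective {V : Type*} {G : SimpleGraph V} {c c' : Corner G} (hne : c ≠ c') :
    Function.Injective (object c c') := by
  rintro (d | _ | _) (d' | _ | _) h <;> simp_all [object]

section Transport

variable {V : Type*} [Fintype V] [DecidableEq V] {G : SimpleGraph V} [DecidableRel G.Adj]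
  {D : Drawing G}

theorem IsPlane.ccw_pos (hD : D.IsPlane) {c c' : Corner G} (hne : c ≠ c') {h k : HalfEdge G}
    (hb : base c c' k = base c c' h) (hk : k ≠ h) :
    0 < ccw (D.outDir c c' h) (D.outDir c c' k) := by
  rw [← objDir_object, ← objDir_object]
  exact ccw_pos_of_ne D.next D.nextAngle D.objDir hD.objDir_ne_zero hD.unitDir_next
    hD.nextAngle_pos next_mem_objectsAt (hD.sum_nextAngle (base c c' h))
    (mem_objectsAt.2 (object_fst c c' h)) (mem_objectsAt.2 ((object_fst c c' k).trans hb))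
    fun h => hk (object_injective hne h)

theorem IsPlane.ccw_cornerDir_dir_pos (hD : D.IsPlane) {c d : G.Dart} (h : d.fst = c.fst) :
    0 < ccw (D.cornerDir c) (D.dir d) :=
  ccw_pos_of_ne D.next D.nextAngle D.objDir hD.objDir_ne_zero hD.unitDir_next
    hD.nextAngle_pos next_mem_objectsAt (hD.sum_nextAngle c.fst) (q := (c, true)) (p := (d, false))
    (mem_objectsAt.2 rfl) (mem_objectsAt.2 h) (by simp)

/-- The sign by which a spinor is multiplied when it passes a dart or a corner. -/
noncomputable def objSign (c₀ : Corner G) (η : Finset (Sym2 V)) (q : G.Dart × Bool) : ℂ :=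
  if q.2 then sign (if q.1 = c₀ then 1 else 0) else sign (if q.1.edge ∈ η then 1 else 0)

/-- The value of a spinor next to a dart or a corner, before passing it counterclockwise. -/
noncomputable def objValue (D : Drawing G) (c₀ : Corner G)
    (P : Corner G → Finset (Sym2 V) → ℂ) (η : Finset (Sym2 V)) (q : G.Dart × Bool) : ℂ :=
  if q.2 then sign (if q.1 = c₀ then 1 else 0) * P q.1 η
  else Complex.exp (Complex.I / 2 * D.rightAngle q.1) * P (D.rot⁻¹ q.1) η

variable {c₀ : Corner G} {P : Corner G → Finset (Sym2 V) → ℂ}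

/-- The rotation rule is split into its two halves, dart to corner and corner to dart. `P d` is the
value after passing the corner `d`; before `c₀` it has the opposite sign. -/
theorem IsSpinor.objValue_next (hP : IsSpinor D c₀ P) {η : Finset (Sym2 V)}
    (q : G.Dart × Bool) (hη : η ∈ sourceSets q.1 c₀) : objValue D c₀ P η (D.next q) =
      objSign c₀ η q * Complex.exp (Complex.I / 2 * D.nextAngle q) * objValue D c₀ P η q := by
  obtain ⟨d, _ | _⟩ := q
  · have h := hP.rot d η hη
    simp only [next_false, objValue, objSign, nextAngle, if_true, Bool.false_eq_true, if_false]
    rw [h, vertexAngle, sign_add]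
    push_cast
    rw [mul_add, Complex.exp_add]
    by_cases hc : d = c₀ <;> simp only [hc, if_true, if_false, sign_one, sign_zero] <;> ring_nf
  · simp only [next_true, objValue, objSign, nextAngle, if_true, Bool.false_eq_true, if_false,
      rot_inv_rot]
    linear_combination (-Complex.exp (Complex.I / 2 * D.rightAngle (D.rot d)) * P d η) *
      sign_mul_self (if d = c₀ then 1 else 0)

/-- The edge is followed on its right side by the face rule for `d.symm`. The π in `faceAngle` gives
exp(-iπ/2) = -i, and the remaining angles belong to the two ends. -/
theorem IsSpinor.objValue_symm (hP : IsSpinor D c₀ P) {η : Finset (Sym2 V)} {d : G.Dart}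
    (hη : η ∈ sourceSets d c₀) (hd : d.edge ∈ η) :
    objValue D c₀ P (symmDiff η {d.edge}) (d.symm, false) =
      -Complex.I * objValue D c₀ P η (d, false) := by
  have hη' : symmDiff η {d.edge} ∈ sourceSets d.symm c₀ := symmDiff_mem_sourceSets d.symm rfl hη
  have h1 := hP.objValue_next (d.symm, false) hη'
  have h2 := hP.face d.symm _ hη'
  have h3 : d.symm.edge ∉ symmDiff η {d.edge} := by
    rw [SimpleGraph.Dart.edge_symm, mem_symmDiff]
    simp [hd]
  have h4 : Complex.exp (-(Complex.I / 2) * D.faceAngle d.symm) = -Complex.I *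
      (Complex.exp (Complex.I / 2 * D.leftAngle d.symm) *
        Complex.exp (Complex.I / 2 * D.rightAngle d)) := by
    rw [faceAngle, SimpleGraph.Dart.symm_symm, ← Complex.exp_neg_pi_div_two_mul_I,
      ← Complex.exp_add, ← Complex.exp_add]
    congr 1
    push_cast; ring
  simp only [next_false, objSign, nextAngle, Bool.false_eq_true, if_false, h3, sign_zero,
    one_mul] at h1
  rw [SimpleGraph.Dart.edge_symm, symmDiff_symmDiff_cancel_right, faceNext_symm, h4] at h2
  apply mul_left_cancel₀ (Complex.exp_ne_zero (Complex.I / 2 * D.leftAngle d.symm))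
  rw [← h1]
  simp only [objValue, if_true, Bool.false_eq_true, if_false]
  rw [h2]
  linear_combination (-Complex.I * Complex.exp (Complex.I / 2 * D.leftAngle d.symm) *
    Complex.exp (Complex.I / 2 * D.rightAngle d) * P (D.rot⁻¹ d) η) *
    sign_mul_self (if d.symm = c₀ then 1 else 0)

/-- Turning at a vertex from a half-edge to the one it is connected to: by the non-crossing
property, an even number of the half-edges which are left over is passed. -/
theorem IsSpinor.objValue_pair (hP : IsSpinor D c₀ P) (hD : D.IsPlane) {c : Corner G}
    (hne : c ≠ c₀) {η η' : Finset (Sym2 V)} (S : D.Smoothing c c₀ η) {h : HalfEdge G}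
    (hh : Present η h) (hη' : η' ∈ sourceSets (object c c₀ h).1 c₀)
    (hsign : objSign c₀ η' (object c c₀ h) = 1) (R : Finset (HalfEdge G))
    (hRpres : ∀ x ∈ R, Present η x ∧ x ≠ h ∧ x ≠ S.pair h) (hRpair : ∀ x ∈ R, S.pair x ∈ R)
    (hRdart : ∀ d, .inl d ∈ R ↔ d.edge ∈ η' ∧ .inl d ≠ S.pair h)
    (hRstart : HalfEdge.start ∉ R)
    (hRfinish : HalfEdge.finish ∈ R ↔ HalfEdge.finish ≠ S.pair h) :
    objValue D c₀ P η' (object c c₀ (S.pair h)) =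
      Complex.exp (Complex.I / 2 * (turn (-D.outDir c c₀ h) (D.outDir c c₀ (S.pair h)) +
        Real.pi : ℝ)) * objValue D c₀ P η' (object c c₀ h) := by
  have hpair : S.pair h ≠ h := (S.pair_ne_iff h).2 hh
  have hinj := object_injective hne
  have hbase := S.base_pair h
  have hQ : ∀ q ∈ objectsAt G (base c c₀ h), objValue D c₀ P η' (D.next q) =
      objSign c₀ η' q * Complex.exp (Complex.I / 2 * D.nextAngle q) * objValue D c₀ P η' q := by
    intro q hq
    refine hP.objValue_next q ?_
    rwa [sourceSets_congr ((mem_objectsAt.1 hq).trans (object_fst c c₀ h).symm)]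
  have htr := transport_arc D.next D.nextAngle D.objDir hD.objDir_ne_zero hD.unitDir_next
    hD.nextAngle_pos next_mem_objectsAt (hD.sum_nextAngle (base c c₀ h))
    (q := object c c₀ h) (p := object c c₀ (S.pair h))
    (mem_objectsAt.2 (object_fst c c₀ h)) (mem_objectsAt.2 ((object_fst c c₀ _).trans hbase))
    (fun h => hpair (hinj h)) (objValue D c₀ P η') (objSign c₀ η') hQ
  have hprod : ∏ q ∈ objectsAt G (base c c₀ h) with q ≠ object c c₀ h ∧
      ccw (D.objDir (object c c₀ h)) (D.objDir q) <
        ccw (D.objDir (object c c₀ h)) (D.objDir (object c c₀ (S.pair h))), objSign c₀ η' q = 1 := by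
    set B := R.filter fun x => base c c₀ x = base c c₀ h ∧
      ccw (D.outDir c c₀ h) (D.outDir c c₀ x) < ccw (D.outDir c c₀ h) (D.outDir c c₀ (S.pair h))
      with hB
    -- `S.pair` acts without fixed points on the left-over half-edges inside the arc: the
    -- non-crossing property keeps partners on the same side. So the signs cancel in pairs.
    have h1 : ∏ x ∈ B, (-1 : ℂ) = 1 := by
      refine prod_involution (fun x _ => S.pair x) (fun _ _ => by norm_num) (fun x hx _ => ?_)
        (fun x hx => ?_) (fun x _ => S.pair_pair x)
      · exact (S.pair_ne_iff x).2 (hRpres x (mem_filter.1 hx).1).1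
      · obtain ⟨hxR, hxb, hxc⟩ := mem_filter.1 hx
        obtain ⟨hxp, hxh, hxh'⟩ := hRpres x hxR
        refine mem_filter.2 ⟨hRpair x hxR, (S.base_pair x).trans hxb, ?_⟩
        exact (S.noncrossing h x hh hxp hxb hxh hxh').1 hxc
    rw [← h1]
    symm
    -- An object of the arc has sign -1 only if it is a dart of a remaining edge or the corner `c₀`,
    -- that is, a half-edge of `R`.
    refine prod_bij_ne_one (fun x _ _ => object c c₀ x) ?_ ?_ ?_ ?_
    · intro x hx _
      obtain ⟨hxR, hxb, hxc⟩ := mem_filter.1 hx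
      refine mem_filter.2 ⟨mem_objectsAt.2 ((object_fst c c₀ x).trans hxb), ?_, ?_⟩
      · exact fun h => (hRpres x hxR).2.1 (hinj h)
      · rw [objDir_object, objDir_object, objDir_object]
        exact hxc
    · intro x _ _ y _ _ hxy
      exact hinj hxy
    · rintro ⟨d, b⟩ hq hs
      obtain ⟨hqb, hqh, hqc⟩ := mem_filter.1 hq
      rw [objDir_object, objDir_object] at hqc
      have hb := mem_objectsAt.1 hqb
      cases b with
      | false =>
        have hd : d.edge ∈ η' := by
          by_contra hd
          simp [objSign, hd] at hs
        have hx : (.inl d : HalfEdge G) ≠ S.pair h := by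
          intro hx
          rw [← hx] at hqc
          exact lt_irrefl _ hqc
        exact ⟨.inl d, mem_filter.2 ⟨(hRdart d).2 ⟨hd, hx⟩, hb, hqc⟩, by norm_num, rfl⟩
      | true =>
        have hd : d = c₀ := by
          by_contra hd
          simp [objSign, hd] at hs
        subst hd
        have hx : (HalfEdge.finish : HalfEdge G) ≠ S.pair h := by
          intro hx
          rw [← hx] at hqc
          exact lt_irrefl _ hqc
        exact ⟨HalfEdge.finish, mem_filter.2 ⟨hRfinish.2 hx, hb, hqc⟩, by norm_num, rfl⟩
    · rintro (d | _ | _) hx _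
      · have := ((hRdart d).1 (mem_filter.1 hx).1).1
        simp [object, objSign, this]
      · exact absurd (mem_filter.1 hx).1 hRstart
      · simp [object, objSign]
  rw [hprod, hsign, objDir_object, objDir_object] at htr
  rw [turn_neg_left (hD.ccw_pos hne hbase hpair), htr]
  congr 3
  push_cast; ring_nf

end Transport

/-! ### The path defined by a smoothing -/

namespace Smoothing

variable {V : Type*} {G : SimpleGraph V} {D : Drawing G} {c c' : Corner G} {η : Finset (Sym2 V)}
  (S : D.Smoothing c c' η)

theorem opposite_opposite (h : HalfEdge G) : opposite (opposite h) = h := by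
  rcases h with d | b
  · exact congrArg Sum.inl d.symm_symm
  · exact congrArg Sum.inr (Bool.not_not b)

theorem opposite_ne (h : HalfEdge G) : opposite h ≠ h := by
  rcases h with d | b
  · exact fun h => d.symm_ne (Sum.inl_injective h)
  · intro h
    have := Sum.inr_injective h
    cases b <;> simp at this

theorem step_apply (h : HalfEdge G) : S.step h = opposite (S.pair h) := rfl

theorem opposite_step (h : HalfEdge G) : opposite (S.step h) = S.pair h :=
  opposite_opposite _

theorem present_opposite (h : HalfEdge G) : Present η (opposite h) ↔ Present η h := by
  rcases h with d | b
  · change d.symm.edge ∈ η ↔ d.edge ∈ η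
    rw [SimpleGraph.Dart.edge_symm]
  · exact Iff.rfl

theorem present_pair (h : HalfEdge G) : Present η (S.pair h) ↔ Present η h := by
  rw [← S.pair_ne_iff, ← S.pair_ne_iff, S.pair_pair, ne_comm]

theorem present_step (h : HalfEdge G) : Present η (S.step h) ↔ Present η h := by
  rw [step_apply, present_opposite, present_pair]

theorem present_zpow (n : ℤ) (h : HalfEdge G) : Present η ((S.step ^ n) h) ↔ Present η h := by
  induction n with
  | zero => simp
  | succ n ih => rw [add_comm, zpow_add, Equiv.Perm.mul_apply, zpow_one, present_step, ih]
  | pred n ih =>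
    rw [← ih, ← S.present_step, sub_eq_neg_add, zpow_add, Equiv.Perm.mul_apply,
      ← Equiv.Perm.mul_apply, ← zpow_one_add]
    simp

/-- Reversing the path: `pair` conjugates `step` to its inverse, since both `pair` and `opposite`
are involutions. -/
theorem pair_zpow (n : ℤ) (h : HalfEdge G) :
    S.pair ((S.step ^ n) h) = (S.step ^ (-n)) (S.pair h) := by
  have h1 : SemiconjBy S.pair S.step S.step⁻¹ := by
    ext x
    rw [Equiv.Perm.mul_apply, Equiv.Perm.mul_apply, Equiv.Perm.eq_inv_iff_eq, step_apply S (S.pair _),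
      S.pair_pair, opposite_step]
  have h2 := Equiv.congr_fun (h1.zpow_right n) h
  rwa [inv_zpow', Equiv.Perm.mul_apply, Equiv.Perm.mul_apply] at h2

/-- The path which arrives through `h` does not pass in the opposite direction. -/
theorem zpow_ne_pair {h : HalfEdge G} (hh : Present η h) (n : ℤ) : (S.step ^ n) h ≠ S.pair h := by
  intro hn
  -- The path and its reversal would meet half-way: at a half-edge fixed by `pair` if `n` is even,
  -- at one fixed by `opposite` if `n` is odd.
  rcases Int.even_or_odd' n with ⟨t, rfl | rfl⟩
  · have h1 : S.pair ((S.step ^ t) h) = (S.step ^ t) h := by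
      rw [pair_zpow, ← hn, ← Equiv.Perm.mul_apply, ← zpow_add]
      congr 2; ring
    exact (S.pair_ne_iff _).2 ((S.present_zpow t h).2 hh) h1
  · have h1 : S.pair ((S.step ^ t) h) = S.step ((S.step ^ t) h) := by
      rw [pair_zpow, ← hn, ← Equiv.Perm.mul_apply, ← zpow_add, ← Equiv.Perm.mul_apply,
        ← zpow_one_add]
      congr 2; ring
    exact opposite_ne _ h1.symm

/-- The half-edge through which the path arrives after `n` steps. -/
def strand (n : ℕ) : HalfEdge G := S.step^[n] HalfEdge.start

theorem strand_zero : S.strand 0 = HalfEdge.start := rfl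

theorem strand_succ (n : ℕ) : S.strand (n + 1) = opposite (S.pair (S.strand n)) :=
  Function.iterate_succ_apply' _ _ _

theorem opposite_strand_succ (n : ℕ) : opposite (S.strand (n + 1)) = S.pair (S.strand n) := by
  rw [strand_succ, opposite_opposite]

theorem strand_eq_pow (n : ℕ) : S.strand n = (S.step ^ (n : ℤ)) HalfEdge.start := by
  rw [zpow_natCast, strand, Equiv.Perm.iterate_eq_pow]

theorem present_strand (n : ℕ) : Present η (S.strand n) := by
  rw [strand_eq_pow, present_zpow]
  trivial

theorem strand_ne_pair (i j : ℕ) : S.strand i ≠ S.pair (S.strand j) := by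
  have h := S.zpow_ne_pair (S.present_strand j) ((i : ℤ) - j)
  rw [S.strand_eq_pow j, ← Equiv.Perm.mul_apply, ← zpow_add, sub_add_cancel,
    ← S.strand_eq_pow i, ← S.strand_eq_pow j] at h
  exact h

/-- The number of steps of the path. -/
noncomputable def length : ℕ := Function.minimalPeriod S.step HalfEdge.start

theorem strand_injOn : Set.InjOn S.strand (Set.Iio S.length) :=
  Function.iterate_injOn_Iio_minimalPeriod

theorem strand_length : S.strand S.length = HalfEdge.start := Function.iterate_minimalPeriod

theorem strand_ne_start {n : ℕ} (h0 : n ≠ 0) (hn : n < S.length) :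
    S.strand n ≠ HalfEdge.start := by
  intro h
  exact h0 (S.strand_injOn hn (Set.mem_Iio.2 (Nat.pos_of_ne_zero h0 |>.trans hn)) h)

section Winding

variable [Fintype V] [DecidableRel G.Adj]

theorem length_pos : 0 < S.length := Function.minimalPeriod_pos_of_mem_periodicPts
  (Function.Injective.mem_periodicPts S.step.injective _)

theorem winding_eq_sum : S.winding = ∑ n ∈ range S.length,
    turn (-D.outDir c c' (S.strand n)) (D.outDir c c' (S.pair (S.strand n))) := by
  classical
  rw [winding]
  symm
  refine sum_bij (fun n _ => S.strand n) ?_ ?_ ?_ (fun _ _ => rfl)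
  · intro n _
    rw [mem_filter_univ]
    exact ⟨n, (S.strand_eq_pow n).symm⟩
  · intro i hi j hj h
    exact S.strand_injOn (mem_range.1 hi) (mem_range.1 hj) h
  · intro h hh
    rw [mem_filter_univ] at hh
    obtain ⟨n, hn⟩ := hh.exists_nat_pow_eq
    refine ⟨n % S.length, mem_range.2 (Nat.mod_lt _ S.length_pos), ?_⟩
    rw [strand, length, Function.iterate_mod_minimalPeriod_eq, Equiv.Perm.iterate_eq_pow, hn]

end Winding

end Smoothing

/-! ### The spinor along the path and the winding phase -/

section Path

variable {V : Type*} [Fintype V] [DecidableEq V] {G : SimpleGraph V} [DecidableRel G.Adj]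
  {D : Drawing G} {c₀ : Corner G} {P : Corner G → Finset (Sym2 V) → ℂ}

namespace Smoothing

variable {c c' : Corner G} {η : Finset (Sym2 V)} (S : D.Smoothing c c' η)

open Classical in
/-- The edges which the path has not passed yet after `n` steps. -/
noncomputable def edgesAfter (n : ℕ) : Finset (Sym2 V) :=
  η.filter fun e => ∀ i ≤ n, ∀ d : G.Dart, S.strand i = .inl d → d.edge ≠ e

open Classical in
/-- The half-edges which are left over when the path leaves the vertex after `n` steps. -/
noncomputable def halvesAfter (n : ℕ) : Finset (HalfEdge G) :=
  univ.filter fun x => Present η x ∧ ∀ i ≤ n, x ≠ S.strand i ∧ x ≠ S.pair (S.strand i)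

theorem mem_edgesAfter {n : ℕ} {e : Sym2 V} : e ∈ S.edgesAfter n ↔
    e ∈ η ∧ ∀ i ≤ n, ∀ d : G.Dart, S.strand i = .inl d → d.edge ≠ e := by
  simp only [edgesAfter, mem_filter]

theorem mem_halvesAfter {n : ℕ} {x : HalfEdge G} : x ∈ S.halvesAfter n ↔
    Present η x ∧ ∀ i ≤ n, x ≠ S.strand i ∧ x ≠ S.pair (S.strand i) := by
  simp only [halvesAfter, mem_filter_univ]

theorem edgesAfter_zero : S.edgesAfter 0 = η := by
  ext e
  rw [mem_edgesAfter]
  refine ⟨fun h => h.1, fun h => ⟨h, fun i hi d hd => ?_⟩⟩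
  obtain rfl : i = 0 := by omega
  cases hd

theorem pair_mem_halvesAfter {n : ℕ} {x : HalfEdge G} (hx : x ∈ S.halvesAfter n) :
    S.pair x ∈ S.halvesAfter n := by
  rw [mem_halvesAfter] at hx ⊢
  refine ⟨(S.present_pair x).2 hx.1, fun i hi => ⟨fun h => ?_, fun h => ?_⟩⟩
  · exact (hx.2 i hi).2 (by rw [← h, S.pair_pair])
  · exact (hx.2 i hi).1 (S.pair.injective h)

theorem strand_eq_symm {n : ℕ} {d : G.Dart} (h : S.pair (S.strand n) = .inl d) :
    S.strand (n + 1) = .inl d.symm := by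
  rw [strand_succ, h]; rfl

theorem pair_strand_eq_symm {n : ℕ} {d : G.Dart} (h : S.strand (n + 1) = .inl d) :
    S.pair (S.strand n) = .inl d.symm := by
  rw [← opposite_strand_succ, h]; rfl

/-- An edge is erased only when the path arrives through its second half, whereas its first half is
used up as soon as the path leaves through it. This is the only discrepancy between the two sets. -/
theorem inl_mem_halvesAfter {n : ℕ} (d : G.Dart) : .inl d ∈ S.halvesAfter n ↔
    d.edge ∈ S.edgesAfter n ∧ .inl d ≠ S.pair (S.strand n) := by
  rw [mem_halvesAfter, mem_edgesAfter]
  constructor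
  · rintro ⟨hd, h⟩
    refine ⟨⟨hd, fun i hi d' hd' hdd => ?_⟩, (h n le_rfl).2⟩
    rcases SimpleGraph.dart_edge_eq_iff d' d |>.1 hdd with rfl | rfl
    · exact (h i hi).1 hd'.symm
    · obtain ⟨j, rfl⟩ : ∃ j, i = j + 1 := Nat.exists_eq_succ_of_ne_zero (by rintro rfl; cases hd')
      have := S.pair_strand_eq_symm hd'
      rw [SimpleGraph.Dart.symm_symm] at this
      exact (h j (by omega)).2 this.symm
  · rintro ⟨⟨hd, h⟩, hn⟩
    refine ⟨hd, fun i hi => ⟨fun hi' => h i hi d hi'.symm rfl, fun hi' => ?_⟩⟩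
    rcases hi.eq_or_lt with rfl | hlt
    · exact hn hi'
    · exact h (i + 1) hlt d.symm (S.strand_eq_symm hi'.symm) (SimpleGraph.Dart.edge_symm d)

theorem pair_strand_eq_finish : S.pair (S.strand (S.length - 1)) = HalfEdge.finish := by
  rw [← opposite_strand_succ, Nat.sub_add_cancel S.length_pos, strand_length]
  rfl

theorem finish_ne_pair_strand {n : ℕ} (hn : n + 1 < S.length) :
    HalfEdge.finish ≠ S.pair (S.strand n) := by
  intro h
  refine S.strand_ne_start n.succ_ne_zero hn ?_
  rw [strand_succ, ← h]; rfl

theorem finish_ne_strand (n : ℕ) : HalfEdge.finish ≠ S.strand n := by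
  rw [← pair_strand_eq_finish S]
  exact (S.strand_ne_pair _ _).symm

theorem finish_mem_halvesAfter {n : ℕ} (hn : n < S.length) :
    HalfEdge.finish ∈ S.halvesAfter n ↔ HalfEdge.finish ≠ S.pair (S.strand n) := by
  rw [mem_halvesAfter]
  refine ⟨fun h => (h.2 n le_rfl).2, fun h => ⟨trivial, fun i hi => ⟨S.finish_ne_strand i, ?_⟩⟩⟩
  rcases hi.eq_or_lt with rfl | hlt
  · exact h
  · exact S.finish_ne_pair_strand (by omega)

theorem exists_pair_strand {n : ℕ} (hn : n + 1 < S.length) :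
    ∃ d : G.Dart, S.pair (S.strand n) = .inl d := by
  rcases h : S.pair (S.strand n) with d | _ | _
  · exact ⟨d, rfl⟩
  · exact absurd h.symm (S.strand_ne_pair 0 n)
  · exact absurd h.symm (S.finish_ne_pair_strand hn)

/-- No edge is passed twice: not in the same direction by minimality of the period, and not in the
opposite one by `strand_ne_pair`. -/
theorem edge_mem_edgesAfter {n : ℕ} (hn : n + 1 < S.length) {d : G.Dart}
    (hd : S.pair (S.strand n) = .inl d) : d.edge ∈ S.edgesAfter n := by
  refine S.mem_edgesAfter.2 ⟨?_, fun i hi d' hd' hdd => ?_⟩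
  · have := (S.present_pair _).2 (S.present_strand n)
    rwa [hd] at this
  · rcases SimpleGraph.dart_edge_eq_iff d' d |>.1 hdd with rfl | rfl
    · exact S.strand_ne_pair i n (hd'.trans hd.symm)
    · have := S.strand_injOn (Set.mem_Iio.2 (by omega)) (Set.mem_Iio.2 hn)
        (hd'.trans (S.strand_eq_symm hd).symm)
      omega

theorem edgesAfter_succ {n : ℕ} (hn : n + 1 < S.length) {d : G.Dart}
    (hd : S.pair (S.strand n) = .inl d) :
    S.edgesAfter (n + 1) = symmDiff (S.edgesAfter n) {d.edge} := by
  have hmem := S.edge_mem_edgesAfter hn hd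
  ext e
  rw [mem_symmDiff, mem_singleton, mem_edgesAfter]
  constructor
  · rintro ⟨he, h⟩
    refine Or.inl ⟨S.mem_edgesAfter.2 ⟨he, fun i hi => h i (by omega)⟩, ?_⟩
    rintro rfl
    exact h (n + 1) le_rfl d.symm (S.strand_eq_symm hd) (SimpleGraph.Dart.edge_symm d)
  · rintro (⟨he, hne⟩ | ⟨rfl, he⟩)
    · rw [mem_edgesAfter] at he
      refine ⟨he.1, fun i hi d' hd' hdd => ?_⟩
      rcases hi.eq_or_lt with rfl | hlt
      · rw [S.strand_eq_symm hd] at hd'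
        obtain rfl := Sum.inl_injective hd'
        exact hne (hdd.symm.trans (SimpleGraph.Dart.edge_symm d))
      · exact he.2 i (by omega) d' hd' hdd
    · exact absurd hmem he

/-- Erasing the passed edges moves the first source along with the path, so the spinor stays
defined. -/
theorem edgesAfter_mem_sourceSets (hη : η ∈ sourceSets c c') {n : ℕ} (hn : n < S.length) :
    S.edgesAfter n ∈ sourceSets (object c c' (S.strand n)).1 c' := by
  induction n with
  | zero => rw [edgesAfter_zero]; exact hη
  | succ n ih =>
    obtain ⟨d, hd⟩ := S.exists_pair_strand hn
    rw [S.edgesAfter_succ hn hd, S.strand_eq_symm hd]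
    refine symmDiff_mem_sourceSets d.symm rfl ?_
    have h1 := ih (by omega)
    have h2 := S.base_pair (S.strand n)
    rw [hd, ← object_fst c c' (S.strand n)] at h2
    rwa [sourceSets_congr (d := d) h2.symm] at h1

theorem objSign_strand (hne : c ≠ c') (n : ℕ) :
    objSign c' (S.edgesAfter n) (object c c' (S.strand n)) = 1 := by
  rcases h : S.strand n with d | _ | _
  · have : d.edge ∉ S.edgesAfter n := fun hd => (S.mem_edgesAfter.1 hd).2 n le_rfl d h rfl
    simp [object, objSign, this]
  · simp [object, objSign, hne]
  · exact absurd h.symm (S.finish_ne_strand n)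

end Smoothing

theorem IsSpinor.objValue_pair_strand (hP : IsSpinor D c₀ P) (hD : D.IsPlane) {c : Corner G}
    (hne : c ≠ c₀) {η : Finset (Sym2 V)} (hη : η ∈ sourceSets c c₀) (S : D.Smoothing c c₀ η)
    {n : ℕ} (hn : n < S.length) :
    objValue D c₀ P (S.edgesAfter n) (object c c₀ (S.pair (S.strand n))) =
      Complex.exp (Complex.I / 2 * (turn (-D.outDir c c₀ (S.strand n))
        (D.outDir c c₀ (S.pair (S.strand n))) + Real.pi : ℝ)) *
      objValue D c₀ P (S.edgesAfter n) (object c c₀ (S.strand n)) := by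
  refine hP.objValue_pair hD hne S (S.present_strand n) (S.edgesAfter_mem_sourceSets hη hn)
    (S.objSign_strand hne n) (S.halvesAfter n) (fun x hx => ?_)
    (fun x hx => S.pair_mem_halvesAfter hx) S.inl_mem_halvesAfter (fun h => ?_)
    (S.finish_mem_halvesAfter hn)
  · rw [S.mem_halvesAfter] at hx
    exact ⟨hx.1, hx.2 n le_rfl⟩
  · exact ((S.mem_halvesAfter.1 h).2 0 (Nat.zero_le _)).1 rfl

theorem exp_half_add_pi (t : ℝ) : Complex.exp (Complex.I / 2 * (t + Real.pi : ℝ)) =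
    Complex.I * Complex.exp (Complex.I / 2 * t) := by
  have h : Complex.I / 2 * (t + Real.pi : ℝ) = Real.pi / 2 * Complex.I + Complex.I / 2 * t := by
    push_cast; ring
  rw [h, Complex.exp_add, Complex.exp_pi_div_two_mul_I]

/-- The factor i from the π in each turn cancels the -i of the following edge, so only the turning
angles accumulate. -/
theorem IsSpinor.objValue_strand (hP : IsSpinor D c₀ P) (hD : D.IsPlane) {c : Corner G}
    (hne : c ≠ c₀) {η : Finset (Sym2 V)} (hη : η ∈ sourceSets c c₀) (S : D.Smoothing c c₀ η)
    {n : ℕ} (hn : n < S.length) :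
    objValue D c₀ P (S.edgesAfter n) (object c c₀ (S.strand n)) =
      Complex.exp (Complex.I / 2 * (∑ i ∈ range n, turn (-D.outDir c c₀ (S.strand i))
        (D.outDir c c₀ (S.pair (S.strand i))) : ℝ)) * P c η := by
  induction n with
  | zero =>
    rw [S.edgesAfter_zero]
    simp [S.strand_zero, object, objValue, hne]
  | succ n ih =>
    obtain ⟨d, hd⟩ := S.exists_pair_strand hn
    have h1 := hP.objValue_pair_strand hD hne hη S (n := n) (by omega)
    have h2 : S.edgesAfter n ∈ sourceSets d c₀ := by
      have h3 := S.edgesAfter_mem_sourceSets hη (n := n) (by omega)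
      have h4 := S.base_pair (S.strand n)
      rw [hd, ← object_fst c c₀ (S.strand n)] at h4
      rwa [sourceSets_congr (d := d) h4.symm] at h3
    have h3 := hP.objValue_symm h2 (S.edge_mem_edgesAfter hn hd)
    rw [ih (by omega), exp_half_add_pi] at h1
    rw [S.edgesAfter_succ hn hd, S.strand_eq_symm hd, sum_range_succ, Complex.ofReal_add, mul_add,
      Complex.exp_add]
    change objValue D c₀ P _ (d.symm, false) = _
    have h4 : object c c₀ (S.pair (S.strand n)) = (d, false) := by rw [hd]; rfl
    rw [h3, ← h4, h1]
    linear_combination (-Complex.exp (Complex.I / 2 * (turn (-D.outDir c c₀ (S.strand n))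
        (D.outDir c c₀ (S.pair (S.strand n))) : ℝ)) *
      Complex.exp (Complex.I / 2 * (∑ i ∈ range n, turn (-D.outDir c c₀ (S.strand i))
        (D.outDir c c₀ (S.pair (S.strand i))) : ℝ)) * P c η) * Complex.I_mul_I

/-- Both corners have the same direction. If they were not connected, the non-crossing property seen
from each of them would order their two partners in opposite ways. -/
theorem Smoothing.pair_start_of_eq (hD : D.IsPlane) {η : Finset (Sym2 V)}
    (S : D.Smoothing c₀ c₀ η) : S.pair HalfEdge.start = HalfEdge.finish := by
  by_contra hsf
  have hfs : S.pair HalfEdge.finish ≠ HalfEdge.start := fun h => hsf (by rw [← h, S.pair_pair])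
  have hpos : ∀ b : Bool, S.pair (.inr b) ≠ .inr (!b) →
      0 < ccw (D.outDir c₀ c₀ (.inr b)) (D.outDir c₀ c₀ (S.pair (.inr b))) := by
    intro b hb
    have h1 := (S.pair_ne_iff (.inr b)).2 trivial
    have h2 := S.base_pair (.inr b)
    rcases h : S.pair (.inr b) with d | b'
    · rw [h] at h2
      cases b <;> exact hD.ccw_cornerDir_dir_pos h2
    · rw [h] at h1 hb
      cases b <;> cases b' <;> simp at h1 hb
  have h1 := (S.noncrossing HalfEdge.start HalfEdge.finish trivial trivial rfl (by simp)
    (Ne.symm hsf)).1 (by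
      change ccw (D.cornerDir c₀) (D.cornerDir c₀) < _
      rw [ccw_self]; exact hpos false hsf)
  have h2 := (S.noncrossing HalfEdge.finish HalfEdge.start trivial trivial rfl (by simp)
    (Ne.symm hfs)).1 (by
      change ccw (D.cornerDir c₀) (D.cornerDir c₀) < _
      rw [ccw_self]; exact hpos true hfs)
  exact lt_asymm h1 h2

/-- The phase of a path does not depend on the non-crossing connections: it is the value of the
spinor. -/
theorem IsSpinor.exp_winding (hP : IsSpinor D c₀ P) (hD : D.IsPlane) {c : Corner G}
    {η : Finset (Sym2 V)} (hη : η ∈ sourceSets c c₀) (S : D.Smoothing c c₀ η) :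
    Complex.exp (-(Complex.I / 2) * S.winding) = P c η := by
  by_cases hne : c = c₀
  · subst hne
    have h1 := S.pair_start_of_eq hD
    have h2 : S.length = 1 := by
      rw [Smoothing.length, Function.minimalPeriod_eq_one_iff_isFixedPt]
      change opposite (S.pair HalfEdge.start) = _
      rw [h1]; rfl
    -- The reversal contributes `arg (-1) = π`, in agreement with exp(-iπ/2) = -i at the source.
    have h3 : S.winding = Real.pi := by
      rw [S.winding_eq_sum, h2, sum_range_one, S.strand_zero, h1]
      change turn (-D.cornerDir c) (D.cornerDir c) = _
      rw [turn, div_neg, div_self (hD.cornerDir_ne_zero c), Complex.arg_neg_one]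
    rw [hP.source η hη, h3, ← Complex.exp_neg_pi_div_two_mul_I]
    congr 1
    ring
  · have hlen := S.length_pos
    set n := S.length - 1 with hn
    have hn' : n < S.length := by omega
    have h1 := hP.objValue_pair_strand hD hne hη S hn'
    have h2 := hP.objValue_strand hD hne hη S hn'
    have h3 : S.pair (S.strand n) = HalfEdge.finish := S.pair_strand_eq_finish
    have h4 : S.edgesAfter n ∈ sourceSets c₀ c₀ := by
      have h5 := S.edgesAfter_mem_sourceSets hη hn'
      have h6 := S.base_pair (S.strand n)
      rw [h3, ← object_fst c c₀ (S.strand n)] at h6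
      rwa [sourceSets_congr (d := c₀) h6.symm] at h5
    -- The path stops before passing `c₀`, where the sign turns the value -i into i.
    have h5 : objValue D c₀ P (S.edgesAfter n) (object c c₀ (S.pair (S.strand n)))
        = Complex.I := by
      rw [h3]
      simp [object, objValue, hP.source _ h4]
    have hw : S.winding = ∑ i ∈ range n, turn (-D.outDir c c₀ (S.strand i))
        (D.outDir c c₀ (S.pair (S.strand i))) + turn (-D.outDir c c₀ (S.strand n))
        (D.outDir c c₀ (S.pair (S.strand n))) := by
      rw [S.winding_eq_sum, ← sum_range_succ]
      congr 2
      omega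
    rw [h5, h2, exp_half_add_pi] at h1
    have h6 : 1 = Complex.exp (Complex.I / 2 * S.winding) * P c η := by
      rw [hw, Complex.ofReal_add, mul_add, Complex.exp_add]
      apply mul_left_cancel₀ Complex.I_ne_zero
      linear_combination h1
    rw [neg_mul, Complex.exp_neg]
    exact inv_eq_of_mul_eq_one_right h6.symm

end Path

end Drawing

/-! ### Existence of non-crossing connections -/

theorem ccw_eq_sub {r z w : ℂ} (hr : r ≠ 0) (hz : z ≠ 0) (hw : w ≠ 0) :
    ccw z w = if ccw r z ≤ ccw r w then ccw r w - ccw r z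
      else ccw r w - ccw r z + 2 * Real.pi := by
  have h1 := exp_I_ccw hr hz
  have h2 := exp_I_ccw hr hw
  have b1 := ccw_nonneg r z
  have b2 := ccw_lt_two_pi r z
  have b3 := ccw_nonneg r w
  have b4 := ccw_lt_two_pi r w
  have h3 : Complex.exp (Complex.I * (ccw r w - ccw r z : ℝ)) * unitDir z = unitDir w := by
    rw [h1, h2, ← mul_assoc, ← Complex.exp_add]
    congr 2
    push_cast; ring
  split_ifs with h
  · exact ccw_eq hz hw (by linarith) (by linarith) h3.symm
  · refine ccw_eq hz hw (by linarith) (by linarith) ?_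
    rw [← h3, Complex.ofReal_add, mul_add, Complex.exp_add]
    have : Complex.exp (Complex.I * (2 * Real.pi : ℝ)) = 1 := by
      rw [mul_comm]; push_cast; exact Complex.exp_two_pi_mul_I
    rw [this, mul_one]

/-- An even number of elements of a linear order can be connected into pairs of neighbours. -/
theorem exists_pairing {α β : Type*} [LinearOrder β] (key : α → β) (s : Finset α)
    (hinj : Set.InjOn key s) (hs : Even s.card) : ∃ f : α → α,
      (∀ x ∈ s, f x ∈ s ∧ f (f x) = x ∧ f x ≠ x) ∧
      ∀ x ∈ s, ∀ y ∈ s, key x < key y → ¬ key y < key (f x) := by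
  classical
  induction hn : s.card using Nat.strong_induction_on generalizing s with
  | _ n ih =>
  rcases s.eq_empty_or_nonempty with rfl | hne
  · exact ⟨id, by simp, by simp⟩
  -- The two smallest elements are connected, and the others by induction.
  obtain ⟨a, ha, hamin⟩ := exists_min_image s key hne
  have hcard : (s.erase a).card + 1 = s.card := card_erase_add_one ha
  have hne' : (s.erase a).Nonempty := by
    rw [← card_pos]
    rcases hs with ⟨m, hm⟩
    omega
  obtain ⟨b, hb, hbmin⟩ := exists_min_image (s.erase a) key hne'
  have hcard' : ((s.erase a).erase b).card + 1 = (s.erase a).card := card_erase_add_one hb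
  obtain ⟨hba, hbs⟩ := mem_erase.1 hb
  have hsub : (s.erase a).erase b ⊆ s := (erase_subset _ _).trans (erase_subset _ _)
  obtain ⟨f, hf, hf'⟩ := ih ((s.erase a).erase b).card (by omega) _
    (hinj.mono hsub) (by rcases hs with ⟨m, hm⟩; exact ⟨m - 1, by omega⟩) rfl
  have hmem : ∀ x, x ∈ (s.erase a).erase b ↔ x ≠ b ∧ x ≠ a ∧ x ∈ s := by
    intro x; rw [mem_erase, mem_erase]
  refine ⟨fun x => if x = a then b else if x = b then a else f x, fun x hx => ?_,
    fun x hx y hy hxy => ?_⟩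
  · by_cases h1 : x = a
    · subst h1
      simp [hba, hbs]
    by_cases h2 : x = b
    · subst h2
      simp [hba, ha, Ne.symm hba]
    · obtain ⟨h3, h4, h5⟩ := hf x ((hmem x).2 ⟨h2, h1, hx⟩)
      obtain ⟨h6, h7, h8⟩ := (hmem _).1 h3
      simp [h1, h2, h4, h5, h6, h7, h8]
  · by_cases h1 : x = a
    · subst h1
      have hyx : y ≠ x := by rintro rfl; exact lt_irrefl _ hxy
      simpa using hbmin y (mem_erase.2 ⟨hyx, hy⟩)
    by_cases h2 : x = b
    · subst h2
      simpa [hba] using hamin y hy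
    · have hx' := (hmem x).2 ⟨h2, h1, hx⟩
      have hya : y ≠ a := by
        rintro rfl
        exact absurd (hamin x hx) (not_le.2 hxy)
      have hyb : y ≠ b := by
        rintro rfl
        exact absurd (hbmin x (mem_erase.2 ⟨h1, hx⟩)) (not_le.2 hxy)
      simpa [h1, h2] using hf' x hx' y ((hmem y).2 ⟨hyb, hya, hy⟩) hxy

namespace Drawing

section Existence

variable {V : Type*} [Fintype V] [DecidableEq V] {G : SimpleGraph V} [DecidableRel G.Adj]
  {D : Drawing G}

open Classical in
/-- The half-edges of `η ∪ {c, c'}` at a vertex. -/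
noncomputable def halfEdgesAt (c c' : Corner G) (η : Finset (Sym2 V)) (v : V) :
    Finset (HalfEdge G) :=
  univ.filter fun h => Present η h ∧ base c c' h = v

theorem mem_halfEdgesAt {c c' : Corner G} {η : Finset (Sym2 V)} {v : V} {h : HalfEdge G} :
    h ∈ halfEdgesAt c c' η v ↔ Present η h ∧ base c c' h = v := by
  simp [halfEdgesAt]

theorem card_darts_at {η : Finset (Sym2 V)} (hη : η ⊆ G.edgeFinset) (v : V) :
    (univ.filter fun d : G.Dart => d.edge ∈ η ∧ d.fst = v).card =
      (η.filter fun e => v ∈ e).card := by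
  refine card_bij (fun d _ => d.edge) ?_ ?_ ?_
  · intro d hd
    obtain ⟨h1, rfl⟩ := (mem_filter_univ d).1 hd
    exact mem_filter.2 ⟨h1, Sym2.mem_mk_left _ _⟩
  · intro d hd d' hd' h
    obtain ⟨-, h1⟩ := (mem_filter_univ d).1 hd
    obtain ⟨-, h2⟩ := (mem_filter_univ d').1 hd'
    rcases SimpleGraph.dart_edge_eq_iff d d' |>.1 h with h | rfl
    · exact h
    · exact absurd (h2.trans h1.symm) d'.fst_ne_snd
  · intro e he
    obtain ⟨he, hv⟩ := mem_filter.1 he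
    obtain ⟨w, rfl⟩ := hv
    exact ⟨⟨(v, w), SimpleGraph.mem_edgeFinset.1 (hη he)⟩, (mem_filter_univ _).2 ⟨he, rfl⟩, rfl⟩

theorem even_card_halfEdgesAt {c c' : Corner G} {η : Finset (Sym2 V)} (hη : η ∈ sourceSets c c')
    (v : V) : Even (halfEdgesAt c c' η v).card := by
  classical
  have h1 : (halfEdgesAt c c' η v).card = (univ.filter fun d : G.Dart =>
      d.edge ∈ η ∧ d.fst = v).card + (univ.filter fun b : Bool =>
        base c c' (.inr b : HalfEdge G) = v).card := by
    rw [← card_disjSum]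
    congr 1
    ext (d | b)
    · rw [mem_halfEdgesAt, inl_mem_disjSum, mem_filter_univ]; rfl
    · rw [mem_halfEdgesAt, inr_mem_disjSum, mem_filter_univ]; exact ⟨fun h => h.2, fun h => ⟨trivial, h⟩⟩
  have h2 : (univ.filter fun b : Bool => base c c' (.inr b : HalfEdge G) = v).card =
      (if v = c.fst then 1 else 0) + (if v = c'.fst then 1 else 0) := by
    rw [card_filter, Fintype.sum_bool, add_comm]
    change (if c.fst = v then 1 else 0) + (if c'.fst = v then 1 else 0) = _
    simp only [eq_comm (a := v)]
  rw [sourceSets, mem_filter, mem_powerset] at hη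
  rw [h1, h2, card_darts_at hη.1, ← add_assoc]
  exact hη.2 v

theorem IsPlane.object_eq_of_ccw_eq (hD : D.IsPlane) {c c' : Corner G} {h k : HalfEdge G} {r : ℂ}
    (hr : r ≠ 0) (hb : base c c' h = base c c' k)
    (hk : ccw r (D.outDir c c' h) = ccw r (D.outDir c c' k)) :
    object c c' h = object c c' k := by
  by_contra hne
  rw [← objDir_object, ← objDir_object] at hk
  have h1 := ccw_pos_of_ne D.next D.nextAngle D.objDir hD.objDir_ne_zero hD.unitDir_next
    hD.nextAngle_pos next_mem_objectsAt (hD.sum_nextAngle (base c c' k))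
    (mem_objectsAt.2 (object_fst c c' k)) (mem_objectsAt.2 ((object_fst c c' h).trans hb)) hne
  rw [ccw_eq_sub hr (hD.objDir_ne_zero _) (hD.objDir_ne_zero _), hk] at h1
  simp at h1

theorem object_eq {c c' : Corner G} {h k : HalfEdge G} (ho : object c c' h = object c c' k)
    (hne : h ≠ k) : c = c' ∧ (h = HalfEdge.start ∧ k = HalfEdge.finish ∨
      h = HalfEdge.finish ∧ k = HalfEdge.start) := by
  rcases h with d | _ | _ <;> rcases k with d' | _ | _ <;> simp_all [object]

/-- Around every vertex, the half-edges can be connected into pairs in a non-crossing way. -/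
theorem IsPlane.exists_pairing_at (hD : D.IsPlane) {c c' : Corner G} {η : Finset (Sym2 V)}
    (hη : η ∈ sourceSets c c') (v : V) : ∃ f : HalfEdge G → HalfEdge G,
      (∀ h ∈ halfEdgesAt c c' η v, f h ∈ halfEdgesAt c c' η v ∧ f (f h) = h ∧ f h ≠ h) ∧
      ∀ h ∈ halfEdgesAt c c' η v, ∀ k ∈ halfEdgesAt c c' η v, k ≠ h → k ≠ f h →
        (ccw (D.outDir c c' h) (D.outDir c c' k) < ccw (D.outDir c c' h) (D.outDir c c' (f h)) ↔
          ccw (D.outDir c c' h) (D.outDir c c' (f k)) <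
            ccw (D.outDir c c' h) (D.outDir c c' (f h))) := by
  obtain ⟨d₀, hd₀⟩ := exists_dart hD v
  -- The circle of directions is cut open at `r`. At the vertex of `c` the cut is at `c`, so that
  -- two equal corners come first in the order and get connected.
  set r : ℂ := if v = c.fst then D.cornerDir c else D.dir d₀ with hr
  have hr0 : r ≠ 0 := by
    rw [hr]
    split_ifs
    · exact hD.cornerDir_ne_zero c
    · exact hD.dir_ne_zero d₀
  have hout : ∀ h, D.outDir c c' h ≠ 0 := fun h => by
    rw [← objDir_object]; exact hD.objDir_ne_zero _
  set a : HalfEdge G → ℝ := fun h => ccw r (D.outDir c c' h) with ha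
  have ha0 : ∀ h, 0 ≤ a h := fun h => ccw_nonneg _ _
  have ha1 : ∀ h, a h < 2 * Real.pi := fun h => ccw_lt_two_pi _ _
  -- The Boolean breaks the only possible tie, between `start` and `finish` when `c = c'`.
  set key : HalfEdge G → ℝ ×ₗ Bool := fun h => toLex (a h, h = HalfEdge.finish) with hkey
  have htie : ∀ h ∈ halfEdgesAt c c' η v, ∀ k ∈ halfEdgesAt c c' η v, a h = a k → h ≠ k →
      c = c' ∧ (h = HalfEdge.start ∧ k = HalfEdge.finish ∨
        h = HalfEdge.finish ∧ k = HalfEdge.start) := by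
    intro h hh k hk hak hne
    rw [mem_halfEdgesAt] at hh hk
    exact object_eq (hD.object_eq_of_ccw_eq hr0 (hh.2.trans hk.2.symm) hak) hne
  have hinj : Set.InjOn key (halfEdgesAt c c' η v) := by
    intro h hh k hk hhk
    by_contra hne
    have h1 : (a h, decide (h = HalfEdge.finish)) = (a k, decide (k = HalfEdge.finish)) :=
      toLex_inj.1 hhk
    rw [Prod.mk.injEq] at h1
    rcases (htie h hh k hk h1.1 hne).2 with ⟨rfl, rfl⟩ | ⟨rfl, rfl⟩ <;> simp at h1
  have hlt : ∀ {h k}, a h < a k → key h < key k := fun hhk => Prod.Lex.toLex_lt_toLex.2 (Or.inl hhk)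
  obtain ⟨f, hf, hf'⟩ := exists_pairing key _ hinj (even_card_halfEdgesAt hη v)
  -- Otherwise `finish` would lie strictly between `start` and its partner.
  have hstart : c = c' → HalfEdge.start ∈ halfEdgesAt c c' η v → f HalfEdge.start = HalfEdge.finish := by
    intro hc hs
    have hvc : c.fst = v := (mem_halfEdgesAt.1 hs).2
    have hfin : HalfEdge.finish ∈ halfEdgesAt c c' η v := mem_halfEdgesAt.2 ⟨trivial, by
      change c'.fst = v
      rw [← hc, hvc]⟩
    have e1 : a HalfEdge.start = 0 := by
      change ccw r (D.cornerDir c) = 0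
      rw [hr, if_pos hvc.symm, ccw_self]
    have e2 : a HalfEdge.finish = 0 := by
      change ccw r (D.cornerDir c') = 0
      rw [hr, if_pos hvc.symm, hc, ccw_self]
    obtain ⟨h1, h2, h3⟩ := hf _ hs
    by_contra hne
    have h4 : 0 < a (f HalfEdge.start) := by
      refine lt_of_le_of_ne (ha0 _) fun h => ?_
      rcases (htie _ h1 _ hs (h.symm.trans e1.symm) h3).2 with ⟨h5, -⟩ | ⟨h5, -⟩
      · exact h3 h5
      · exact hne h5
    refine hf' _ hs _ hfin ?_ (hlt (by rw [e2]; exact h4))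
    refine Prod.Lex.toLex_lt_toLex.2 (Or.inr ⟨e1.trans e2.symm, ?_⟩)
    simp
  have htie' : ∀ h ∈ halfEdgesAt c c' η v, ∀ k ∈ halfEdgesAt c c' η v, a h = a k → h ≠ k →
      k = f h := by
    intro h hh k hk hak hne
    obtain ⟨hc, ⟨rfl, rfl⟩ | ⟨rfl, rfl⟩⟩ := htie h hh k hk hak hne
    · exact (hstart hc hh).symm
    · rw [← hstart hc hk, (hf _ hk).2.1]
  have hbetween : ∀ h ∈ halfEdgesAt c c' η v, ∀ k ∈ halfEdgesAt c c' η v, a h < a k →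
      a k < a (f h) → False := fun h hh k hk h1 h2 => hf' h hh k hk (hlt h1) (hlt h2)
  refine ⟨f, hf, ?_⟩
  intro h hh
  obtain ⟨hp, hfp, hph⟩ := hf h hh
  -- Nothing lies strictly between connected neighbours in the linear order. So all other half-edges
  -- lie on the same side, and this side depends only on the order of `h` and `f h`.
  have key : ∀ k ∈ halfEdgesAt c c' η v, k ≠ h → k ≠ f h →
      (ccw (D.outDir c c' h) (D.outDir c c' k) < ccw (D.outDir c c' h) (D.outDir c c' (f h)) ↔
        a (f h) < a h) := by
    intro k hk hkh hkp
    have n1 : a k ≠ a h := fun h1 => hkp (htie' h hh k hk h1.symm hkh.symm)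
    have n2 : a k ≠ a (f h) := fun h1 => hkh (by
      rw [htie' _ hp k hk h1.symm hkp.symm, hfp])
    rw [ccw_eq_sub hr0 (hout h) (hout k), ccw_eq_sub hr0 (hout h) (hout (f h))]
    change (if a h ≤ a k then a k - a h else a k - a h + 2 * Real.pi) <
      (if a h ≤ a (f h) then a (f h) - a h else a (f h) - a h + 2 * Real.pi) ↔ _
    have b1 := ha0 k
    have b2 := ha1 k
    have b3 := ha0 (f h)
    have b4 := ha1 (f h)
    have c1 := hbetween h hh k hk
    have c2 := hbetween _ hp k hk
    rw [hfp] at c2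
    split_ifs with i1 i2 i2
    · constructor
      · intro i3
        exact (c1 (lt_of_le_of_ne i1 n1.symm) (by linarith)).elim
      · intro i3
        exact absurd i2 (not_le.2 i3)
    · constructor
      · intro _
        exact not_le.1 i2
      · intro _
        linarith
    · constructor
      · intro i3
        linarith
      · intro i3
        exact absurd i2 (not_le.2 i3)
    · constructor
      · intro _
        exact not_le.1 i2
      · intro _
        rcases lt_or_gt_of_ne n2 with i3 | i3
        · linarith
        · exact (c2 i3 (not_le.1 i1)).elim
  intro k hk hkh hkp
  obtain ⟨hm, hfm, hmk⟩ := hf k hk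
  rw [key k hk hkh hkp, key (f k) hm (fun h => hkp (by rw [← h, hfm]))
    (fun h => hkh (by rw [← hfm, h, hfp]))]

theorem IsPlane.nonempty_smoothing (hD : D.IsPlane) {c c' : Corner G} {η : Finset (Sym2 V)}
    (hη : η ∈ sourceSets c c') : Nonempty (D.Smoothing c c' η) := by
  classical
  choose f hf hf' using hD.exists_pairing_at hη
  set p : HalfEdge G → HalfEdge G := fun h => if Present η h then f (base c c' h) h else h with hp
  have hmem : ∀ h, Present η h → h ∈ halfEdgesAt c c' η (base c c' h) := fun h hh =>
    mem_halfEdgesAt.2 ⟨hh, rfl⟩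
  have hpres : ∀ h, Present η h → p h = f (base c c' h) h ∧ Present η (p h) ∧
      base c c' (p h) = base c c' h := by
    intro h hh
    have h1 : p h = f (base c c' h) h := if_pos hh
    have h2 := mem_halfEdgesAt.1 (hf _ h (hmem h hh)).1
    rw [h1]
    exact ⟨rfl, h2⟩
  have hpp : ∀ h, p (p h) = h := by
    intro h
    by_cases hh : Present η h
    · obtain ⟨h1, h2, h3⟩ := hpres h hh
      rw [(hpres _ h2).1, h3, h1]
      exact (hf _ h (hmem h hh)).2.1
    · have h1 : p h = h := if_neg hh
      rw [h1, h1]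
  refine ⟨⟨⟨p, p, hpp, hpp⟩, hpp, fun h => ?_, fun h => ?_, fun h k hh hk hb hkh hkp => ?_⟩⟩
  · change p h ≠ h ↔ _
    by_cases hh : Present η h
    · rw [(hpres h hh).1]
      exact ⟨fun _ => hh, fun _ => (hf _ h (hmem h hh)).2.2⟩
    · have h1 : p h = h := if_neg hh
      simp [h1, hh]
  · change base c c' (p h) = _
    by_cases hh : Present η h
    · exact (hpres h hh).2.2
    · have h1 : p h = h := if_neg hh
      rw [h1]
  · change k ≠ p h at hkp
    change _ < ccw _ (D.outDir c c' (p h)) ↔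
      ccw _ (D.outDir c c' (p k)) < ccw _ (D.outDir c c' (p h))
    rw [(hpres h hh).1] at hkp ⊢
    rw [(hpres k hk).1, hb]
    refine hf' _ h (hmem h hh) k ?_ hkh hkp
    rw [← hb]
    exact hmem k hk

end Existence

end Drawing

/-! ### Positivity of the partition function -/

section PartitionFunction

variable {V : Type*} [Fintype V] [DecidableEq V] {G : SimpleGraph V} [DecidableRel G.Adj]

/-- The value of a spin. -/
def spin (b : Bool) : ℝ := if b then 1 else -1

theorem abs_spin (b : Bool) : |spin b| = 1 := by
  cases b <;> simp [spin]

theorem sum_spin_pow (n : ℕ) : ∑ b : Bool, spin b ^ n = if Even n then 2 else 0 := by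
  rw [Fintype.sum_bool]
  split_ifs with h
  · simp [spin, h.neg_one_pow]; norm_num
  · simp [spin, (Nat.not_even_iff_odd.1 h).neg_one_pow]

/-- The high-temperature expansion of the partition function of the Ising model. -/
theorem sum_prod_one_add_spin (x : Sym2 V → ℝ) :
    ∑ τ : V → Bool, ∏ e ∈ G.edgeFinset, (1 + x e * ∏ v, if v ∈ e then spin (τ v) else 1) =
      2 ^ Fintype.card V * ∑ η ∈ evenSets G, ∏ e ∈ η, x e := by
  have h1 : ∀ η : Finset (Sym2 V), ∑ τ : V → Bool, ∏ e ∈ η, (x e *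
      ∏ v, if v ∈ e then spin (τ v) else 1) = if ∀ v, Even (η.filter fun e => v ∈ e).card
        then 2 ^ Fintype.card V * ∏ e ∈ η, x e else 0 := by
    intro η
    have h2 : ∀ τ : V → Bool, ∏ e ∈ η, (x e * ∏ v, if v ∈ e then spin (τ v) else 1) =
        (∏ e ∈ η, x e) * ∏ v, spin (τ v) ^ (η.filter fun e => v ∈ e).card := by
      intro τ
      rw [prod_mul_distrib, prod_comm]
      congr 1
      refine prod_congr rfl fun v _ => ?_
      rw [← prod_filter, prod_const]
    have h3 := prod_univ_sum (fun _ : V => (univ : Finset Bool))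
      (fun v b => spin b ^ (η.filter fun e => v ∈ e).card)
    rw [Fintype.piFinset_univ] at h3
    rw [sum_congr rfl fun τ _ => h2 τ, ← mul_sum, ← h3]
    simp only [sum_spin_pow]
    split_ifs with h
    · rw [prod_congr rfl fun v _ => if_pos (h v), prod_const, card_univ, mul_comm]
    · push Not at h
      obtain ⟨v, hv⟩ := h
      rw [prod_eq_zero (mem_univ v) (if_neg hv), mul_zero]
  simp only [prod_one_add]
  rw [sum_comm, sum_congr rfl fun η _ => h1 η, ← sum_filter, mul_sum]
  rfl

/-- The couplings may be negative, so single terms have no definite sign. In the sum over spins,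
however, each factor 1 ± x is positive. -/
theorem sum_evenSets_ne_zero {x : Sym2 V → ℝ} (hx : ∀ e, |x e| < 1) :
    ∑ η ∈ evenSets G, ∏ e ∈ η, (x e : ℂ) ≠ 0 := by
  have h1 : 0 < ∑ η ∈ evenSets G, ∏ e ∈ η, x e := by
    have h2 : 0 < 2 ^ Fintype.card V * ∑ η ∈ evenSets G, ∏ e ∈ η, x e := by
      rw [← sum_prod_one_add_spin]
      refine sum_pos (fun τ _ => prod_pos fun e _ => ?_) univ_nonempty
      have h3 : |∏ v, if v ∈ e then spin (τ v) else 1| = 1 := by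
        rw [abs_prod]
        refine prod_eq_one fun v _ => ?_
        split_ifs
        · exact abs_spin _
        · exact abs_one
      have h4 : |x e * ∏ v, if v ∈ e then spin (τ v) else 1| < 1 := by
        rw [abs_mul, h3, mul_one]
        exact hx e
      linarith [(abs_lt.1 h4).1]
    exact pos_of_mul_pos_right h2 (by positivity)
  exact_mod_cast h1.ne'

end PartitionFunction

namespace Drawing

/-! ### The Kasteleyn matrix and its inverse -/

section Kasteleyn

variable {V : Type*} [Fintype V] [DecidableEq V] {G : SimpleGraph V} [DecidableRel G.Adj]
  {D : Drawing G}

/-- The sum over the sets of edges with sources at `c` and `c₀`, with the phases of a spinor. -/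
noncomputable def spinorSum (c₀ : Corner G) (P : Corner G → Finset (Sym2 V) → ℂ) (x : Sym2 V → ℝ)
    (c : Corner G) : ℂ :=
  ∑ η ∈ sourceSets c c₀, P c η * ∏ e ∈ η, (x e : ℂ)

theorem prod_symmDiff_of_notMem {η : Finset (Sym2 V)} {e : Sym2 V} (he : e ∉ η) (x : Sym2 V → ℂ) :
    ∏ e' ∈ symmDiff η {e}, x e' = x e * ∏ e' ∈ η, x e' := by
  have h : symmDiff η {e} = insert e η := by
    ext a; by_cases ha : a = e <;> simp [mem_symmDiff, ha, he]
  rw [h, prod_insert he]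

/-- For each η, both neighbouring spinor values are multiples of `P d η`, with η toggled at the edge
of `d` in the face term. The three terms then add up to (s - 1) `P d η`, where s = -1 at `c₀` and s
= 1 elsewhere. -/
theorem IsSpinor.spinorSum_relation {c₀ : Corner G} {P : Corner G → Finset (Sym2 V) → ℂ}
    (hP : IsSpinor D c₀ P) (x : Sym2 V → ℝ) (d : Corner G) :
    -spinorSum c₀ P x d +
      Complex.exp (Complex.I / 2 * D.vertexAngle d) *
        (((1 - x d.edge ^ 2) / (1 + x d.edge ^ 2) : ℝ) : ℂ) * spinorSum c₀ P x (D.rot⁻¹ d) +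
      Complex.exp (-(Complex.I / 2) * D.faceAngle d) *
        ((2 * x d.edge / (1 + x d.edge ^ 2) : ℝ) : ℂ) * spinorSum c₀ P x (D.faceNext d) =
    if d = c₀ then 2 * Complex.I * ∑ η ∈ evenSets G, ∏ e ∈ η, (x e : ℂ) else 0 := by
  set s := sign (if d = c₀ then 1 else 0) with hs
  have hF : spinorSum c₀ P x (D.faceNext d) = ∑ η ∈ sourceSets d c₀,
      P (D.faceNext d) (symmDiff η {d.edge}) * ∏ e ∈ symmDiff η {d.edge}, (x e : ℂ) := by
    symm
    refine sum_bij' (fun η _ => symmDiff η {d.edge}) (fun η _ => symmDiff η {d.edge})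
      (fun η hη => symmDiff_mem_sourceSets _ (D.faceNext_fst d) hη) (fun η hη => ?_)
      (fun η _ => symmDiff_symmDiff_cancel_right _ _)
      (fun η _ => symmDiff_symmDiff_cancel_right _ _) (fun _ _ => rfl)
    rw [sourceSets_congr (d := d.symm) (D.faceNext_fst d)] at hη
    have := symmDiff_mem_sourceSets d rfl hη
    rwa [SimpleGraph.Dart.edge_symm] at this
  have hR : spinorSum c₀ P x (D.rot⁻¹ d) = ∑ η ∈ sourceSets d c₀,
      P (D.rot⁻¹ d) η * ∏ e ∈ η, (x e : ℂ) := by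
    rw [spinorSum, sourceSets_congr (D.rot_inv_fst d)]
  have hx : (1 + (x d.edge : ℂ) ^ 2) ≠ 0 := by
    have : (1 + x d.edge ^ 2) ≠ 0 := by positivity
    exact_mod_cast this
  have key : -spinorSum c₀ P x d +
      Complex.exp (Complex.I / 2 * D.vertexAngle d) *
        (((1 - x d.edge ^ 2) / (1 + x d.edge ^ 2) : ℝ) : ℂ) * spinorSum c₀ P x (D.rot⁻¹ d) +
      Complex.exp (-(Complex.I / 2) * D.faceAngle d) *
        ((2 * x d.edge / (1 + x d.edge ^ 2) : ℝ) : ℂ) * spinorSum c₀ P x (D.faceNext d) =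
      (s - 1) * spinorSum c₀ P x d := by
    rw [hF, hR, spinorSum, mul_sum, mul_sum, mul_sum, ← sum_neg_distrib, ← sum_add_distrib,
      ← sum_add_distrib]
    refine sum_congr rfl fun η hη => ?_
    have h1 := hP.rot d η hη
    have h2 := hP.face d η hη
    rw [sign_add] at h1
    push_cast
    have hss : s * s = 1 := sign_mul_self _
    rw [← hs] at h1 h2
    set E := Complex.exp (Complex.I / 2 * D.vertexAngle d)
    set E' := Complex.exp (-(Complex.I / 2) * D.faceAngle d)
    have h2' : E' * P (D.faceNext d) (symmDiff η {d.edge}) = s * P d η := by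
      linear_combination -s * h2 - E' * P (D.faceNext d) (symmDiff η {d.edge}) * hss
    -- If the edge is in η, the weights satisfy 2x - (1 - x²)x = x(1 + x²); otherwise (1 - x²) +
    -- 2x·x = 1 + x².
    by_cases he : d.edge ∈ η
    · have hw := prod_symmDiff_of_notMem (η := symmDiff η {d.edge}) (e := d.edge)
        (by simp [mem_symmDiff, he]) (fun e => (x e : ℂ))
      rw [symmDiff_symmDiff_cancel_right] at hw
      rw [if_pos he, sign_one] at h1
      have h1' : E * P (D.rot⁻¹ d) η = -s * P d η := by
        linear_combination s * h1 - E * P (D.rot⁻¹ d) η * hss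
      rw [hw]
      set w := ∏ e ∈ symmDiff η {d.edge}, (x e : ℂ)
      have h3 : ∀ a b : ℂ, -(P d η * (x d.edge * w)) + E * a * (P (D.rot⁻¹ d) η * (x d.edge * w)) +
          E' * b * (P (D.faceNext d) (symmDiff η {d.edge}) * w) =
          -(P d η * (x d.edge * w)) + a * (-s * P d η) * (x d.edge * w) +
            b * (s * P d η) * w := by
        intro a b
        rw [← h1', ← h2']; ring
      rw [h3]
      field_simp
      ring
    · have hw := prod_symmDiff_of_notMem he (fun e => (x e : ℂ))
      rw [if_neg he, sign_zero] at h1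
      have h1' : E * P (D.rot⁻¹ d) η = s * P d η := by
        linear_combination -s * h1 - E * P (D.rot⁻¹ d) η * hss
      rw [hw]
      set w := ∏ e ∈ η, (x e : ℂ)
      have h3 : ∀ a b : ℂ, -(P d η * w) + E * a * (P (D.rot⁻¹ d) η * w) +
          E' * b * (P (D.faceNext d) (symmDiff η {d.edge}) * (x d.edge * w)) =
          -(P d η * w) + a * (s * P d η) * w + b * (s * P d η) * (x d.edge * w) := by
        intro a b
        linear_combination (a * w) * h1' + (b * x d.edge * w) * h2'
      rw [h3]
      field_simp
      ring
  rw [key, hs]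
  -- At `c₀` the factor (s - 1)(-i) is 2i, and the sets with two sources at the same vertex are the
  -- even sets.
  by_cases hd : d = c₀
  · subst hd
    rw [if_pos rfl, if_pos rfl, sign_one, spinorSum, sum_congr rfl fun η hη => by rw [hP.source η hη],
      sourceSets_eq_evenSets rfl, ← mul_sum]
    ring
  · rw [if_neg hd, if_neg hd, sign_zero, sub_self, zero_mul]

theorem kasteleyn_mul (x : Sym2 V → ℝ) (M : Matrix (Corner G) (Corner G) ℂ) (d c : Corner G) :
    (D.kasteleyn x leftEnd D.rightEnd * M) d c = -M d c +
      Complex.exp (Complex.I / 2 * D.vertexAngle d) *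
        (((1 - x d.edge ^ 2) / (1 + x d.edge ^ 2) : ℝ) : ℂ) * M (D.rot⁻¹ d) c +
      Complex.exp (-(Complex.I / 2) * D.faceAngle d) *
        ((2 * x d.edge / (1 + x d.edge ^ 2) : ℝ) : ℂ) * M (D.faceNext d) c := by
  have h1 : ∀ w, D.kasteleyn x leftEnd D.rightEnd d w * M w c =
      ∑ k : EdgeKind, if D.rightEnd (k, d) = w then
        D.phase (k, d) * (dimerWeight x (k, d) : ℂ) * M w c else 0 := by
    intro w
    rw [kasteleyn, sum_mul, sum_filter, Fintype.sum_prod_type]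
    refine sum_congr rfl fun k _ => ?_
    rw [sum_eq_single d]
    · simp [leftEnd]
    · intro d' _ hd'
      simp [leftEnd, hd']
    · simp
  rw [Matrix.mul_apply, sum_congr rfl fun w _ => h1 w, sum_comm]
  simp only [sum_ite_eq, mem_univ, if_true]
  have h2 : (univ : Finset EdgeKind) = {.road, .primalStreet, .dualStreet} := rfl
  rw [h2, sum_insert (by decide), sum_insert (by decide), sum_singleton]
  simp only [phase, dimerWeight, rightEnd]
  push_cast
  ring

theorem kasteleyn_swap (x : Sym2 V → ℝ) :
    D.kasteleyn x D.rightEnd leftEnd = (D.kasteleyn x leftEnd D.rightEnd).transpose := by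
  ext b w
  rw [Matrix.transpose_apply, kasteleyn, kasteleyn]
  simp only [and_comm]

theorem IsSpinor.observable_eq {c₀ : Corner G} {P : Corner G → Finset (Sym2 V) → ℂ}
    (hP : IsSpinor D c₀ P) (hD : D.IsPlane) (x : Sym2 V → ℝ) (c : Corner G)
    (S : D.Smoothings c c₀) : D.observable x c c₀ S =
      spinorSum c₀ P x c / ∑ η ∈ evenSets G, ∏ e ∈ η, (x e : ℂ) := by
  have h : ∀ η : {η // η ∈ sourceSets c c₀}, Complex.exp (-(Complex.I / 2) * (S η).winding) *
      ∏ e ∈ η.1, (x e : ℂ) = P c η.1 * ∏ e ∈ η.1, (x e : ℂ) := fun η => by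
    rw [hP.exp_winding hD η.2 (S η)]
  rw [observable, sum_congr rfl fun η _ => h η, spinorSum,
    ← sum_coe_sort (sourceSets c c₀) fun η => P c η * ∏ e ∈ η, (x e : ℂ)]

/-- The constant -i/2 is the inverse of the source term 2i. `M` is built from spinors, so it is the
same for all smoothings. -/
theorem IsPlane.kasteleyn_mul_eq_one (hD : D.IsPlane) {x : Sym2 V → ℝ} (hx : ∀ e, |x e| < 1) :
    ∃ M : Matrix (Corner G) (Corner G) ℂ, D.kasteleyn x leftEnd D.rightEnd * M = 1 ∧
      ∀ c c' (S : D.Smoothings c c'), M c c' = -(Complex.I / 2) * D.observable x c c' S := by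
  choose P hP using hD.exists_isSpinor
  have hZ := sum_evenSets_ne_zero (G := G) hx
  refine ⟨Matrix.of fun c c' => -(Complex.I / 2) * (spinorSum c' (P c') x c /
    ∑ η ∈ evenSets G, ∏ e ∈ η, (x e : ℂ)), ?_, fun c c' S => by
      rw [(hP c').observable_eq hD]; rfl⟩
  ext d c
  have h := (hP c).spinorSum_relation x d
  rw [kasteleyn_mul, Matrix.one_apply]
  simp only [Matrix.of_apply]
  set Z := ∑ η ∈ evenSets G, ∏ e ∈ η, (x e : ℂ)
  have h2 := congrArg (fun t => -(Complex.I / 2) * (t / Z)) h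
  refine Eq.trans ?_ (h2.trans ?_)
  · ring
  · split_ifs
    · rw [mul_div_assoc, div_self hZ]
      linear_combination -Complex.I_mul_I
    · simp

end Kasteleyn

end Drawing

end PlanarIsing

theorem proposition2p14 {V : Type*} [Fintype V] [DecidableEq V] (G : SimpleGraph V)
    [DecidableRel G.Adj] (D : PlanarIsing.Drawing G) (hD : D.IsPlane)
    (β : ℝ) (J : Sym2 V → ℝ) (x : Sym2 V → ℝ) (hx : ∀ e, x e = Real.tanh (β * J e)) :
    (∀ c c' : PlanarIsing.Corner G, Nonempty (D.Smoothings c c')) ∧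
    IsUnit (D.kasteleyn x PlanarIsing.Drawing.leftEnd D.rightEnd).det ∧
    IsUnit (D.kasteleyn x D.rightEnd PlanarIsing.Drawing.leftEnd).det ∧
    (∀ (c c' : PlanarIsing.Corner G) (S : D.Smoothings c c'),
      (D.kasteleyn x PlanarIsing.Drawing.leftEnd D.rightEnd)⁻¹ c c'
        = -(Complex.I / 2) * D.observable x c c' S) ∧
    (∀ (c c' : PlanarIsing.Corner G) (S : D.Smoothings c' c),
      (D.kasteleyn x D.rightEnd PlanarIsing.Drawing.leftEnd)⁻¹ c c'
        = -(Complex.I / 2) * D.observable x c' c S) := by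
  have hx' : ∀ e, |x e| < 1 := fun e => by
    rw [hx, abs_lt]
    exact ⟨Real.neg_one_lt_tanh _, Real.tanh_lt_one _⟩
  obtain ⟨M, hM, hobs⟩ := hD.kasteleyn_mul_eq_one hx'
  have hinv := Matrix.inv_eq_right_inv hM
  have hdet := Matrix.isUnit_det_of_right_inverse hM
  refine ⟨fun c c' => ⟨fun η => (hD.nonempty_smoothing η.2).some⟩, hdet, ?_, ?_, ?_⟩
  · rw [PlanarIsing.Drawing.kasteleyn_swap, Matrix.det_transpose]
    exact hdet
  · intro c c' S
    rw [hinv, hobs c c' S]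
  · intro c c' S
    rw [PlanarIsing.Drawing.kasteleyn_swap, ← Matrix.transpose_nonsing_inv, hinv,
      Matrix.transpose_apply, hobs c' c S]
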